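/- A doubly even binary code of length $m$ is a subspace $V\subseteq\mathbb F_2^m$ all of whose Hamming weights $|v|$ are divisible by $4$; write $|u\cap v|$, $|u\cap v\cap w|$ for the numbers of common $1$'s. A factor set on $V$ is a map $\phi:V\times V\to\{1,-1\}$ with $\phi(v,v)=(-1)^{|v|/4}$, $\phi(v,w)=(-1)^{|v\cap w|/2}\phi(w,v)$, $\phi(0,v)=\phi(v,0)=1$ and $\phi(v+w,u)=\phi(v,w+u)\phi(v,w)\phi(w,u)(-1)^{|v\cap w\cap u|}$. The code loop $L(V)$ is $\{1,-1\}\times V$ with the product $(s,v)(t,w)=(st\,\phi(v,w),v+w)$; it is a Moufang loop. Its rank is $\dim V$. Code loops of rank $n$ are the Moufang loops isomorphic to such an $L(V)$ with $\dim V=n$. A representation of degree $m$ of a code loop $L$ is a doubly even code $V\subseteq\mathbb F_2^m$ with $L\cong L(V)$ (for some factor set on $V$). Two coordinates $i,j\in\{1,\dots,m\}$ are equivalent if $v_i=v_j$ for all $v\in V$. The representation is reduced if every equivalence class has fewer than $8$ elements, and a reduced representation is minimal if no representation of $L$ has smaller degree. The type of $V$ is the list of the sizes of the equivalence classes in increasing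 order. Let $C_i^4$ ($1\le i\le 16$) be the code loop of rank $4$ generated by $a,b,c,d$ with $(a,b,c)=-1$, $(a,b,d)=(a,c,d)=(b,c,d)=1$ and $$a^2=(-1)^{\lambda_1},\ b^2=(-1)^{\lambda_2},\ c^2=(-1)^{\lambda_3},\ d^2=(-1)^{\lambda_4},\ [a,b]=(-1)^{\lambda_5},\ [a,c]=(-1)^{\lambda_6},\ [a,d]=(-1)^{\lambda_7},\ [b,c]=(-1)^{\lambda_8},\ [b,d]=(-1)^{\lambda_9},\ [c,d]=(-1)^{\lambda_{10}},$$ where $(x,y,z)=((xy)z)(x(yz))^{-1}$, $[x,y]=x^{-1}y^{-1}xy$, the element $-1\ne1$ is central with every square, commutator and associator in $\{1,-1\}$, and $\lambda=(\lambda_1\dots\lambda_{10})$ is given in the table below. Then each $C_i^4$ exists and has a minimal representation, and every minimal representation of $C_i^4$ has the following degree and type: $$\begin{array}{r|l|r|l} i&\lambda&\text{degree}&\text{type}\\\hline 1&1110110100&8&(11111111)\\ 2&0000000000&14&(11111111222)\\ 3&0000110100&12&(111111114)\\ 4&0010100000&18&(11111111226)\\ 5&0000010100&18&(111111112224)\\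 6&1111110100&11&(11111114)\\ 7&0001000000&17&(11113334)\\ 8&0000001000&17&(11111122223)\\ 9&0100001000&19&(11111222233)\\ 10&0001111000&19&(111223333)\\ 11&0001001000&17&(111122333)\\ 12&0000001100&17&(1111112234)\\ 13&0110111100&17&(111111236)\\ 14&0001001100&13&(111111223)\\ 15&1001001100&17&(111111227)\\ 16&0001111100&17&(111112235) \end{array}$$ -/

import Mathlib

namespace CodeLoops

/-- A Moufang loop: a set with a product, a two-sided identity and two-sided inverses
(so that left and right translations are bijective), satisfying the Moufang identity. -/
class MoufangLoop (L : Type*) extends MulOneClass L, Inv L where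
  inv_mul_cancel_left (x y : L) : x⁻¹ * (x * y) = y
  mul_inv_cancel_right (y x : L) : (y * x) * x⁻¹ = y
  moufang (x y z : L) : z * (x * (z * y)) = ((z * x) * z) * y

section Loops

variable {L : Type*} [MoufangLoop L]

/-- The commutator `[u, v] = u⁻¹ v⁻¹ u v` (the bracketing is immaterial in a Moufang loop). -/
def commutator (u v : L) : L := (u⁻¹ * v⁻¹) * (u * v)

/-- The associator `(u, v, w) = ((u v) w) (u (v w))⁻¹`. -/
def associator (u v w : L) : L := ((u * v) * w) * (u * (v * w))⁻¹

variable (L) in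
/-- The centre of a loop. -/
def center : Set L := {x | ∀ y z : L, commutator x y = 1 ∧ associator x y z = 1}

/-- `z` plays the role of `-1`: it is a central element, different from `1`, and modulo `{1, z}`
the loop is an elementary abelian 2-group, that is, every square, commutator and associator
is `1` or `z`. -/
structure IsNegOne (z : L) : Prop where
  ne_one : z ≠ 1
  mem_center : z ∈ center L
  sq (u : L) : u * u = 1 ∨ u * u = z
  comm (u v : L) : commutator u v = 1 ∨ commutator u v = z
  assoc (u v w : L) : associator u v w = 1 ∨ associator u v w = z

/-- `(-1)^e` for `e ∈ 𝔽₂`, where `z` is the element `-1` of the loop. -/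
def negOnePow (z : L) (e : ZMod 2) : L := if e = 0 then 1 else z

/-- The set `X` generates the loop `L`. -/
def Generates (X : Set L) : Prop :=
  ∀ S : Set L, X ⊆ S → (1 : L) ∈ S → (∀ u ∈ S, ∀ v ∈ S, u * v ∈ S) → (∀ u ∈ S, u⁻¹ ∈ S) →
    S = Set.univ

end Loops

section Codes

variable {m : ℕ}

/-- The Hamming weight `|v|`. As `u * v` is the coordinatewise product, `wt (u * v) = |u ∩ v|`
and `wt (u * v * w) = |u ∩ v ∩ w|`. -/
def wt (v : Fin m → ZMod 2) : ℕ := hammingNorm v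

/-- A doubly even binary code of length `m`: a subspace of `𝔽₂^m` all of whose weights
are divisible by 4. -/
def IsDoublyEven (V : Submodule (ZMod 2) (Fin m → ZMod 2)) : Prop := ∀ v ∈ V, 4 ∣ wt v

/-- A factor set `φ : V × V → {1, -1}` of a doubly even code. -/
structure IsFactorSet (V : Submodule (ZMod 2) (Fin m → ZMod 2)) (φ : V → V → ℤˣ) : Prop where
  diag (v : V) : φ v v = (-1) ^ (wt v.1 / 4)
  swap (v w : V) : φ v w = (-1) ^ (wt (v.1 * w.1) / 2) * φ w v
  zero_left (v : V) : φ 0 v = 1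
  zero_right (v : V) : φ v 0 = 1
  cocycle (v w u : V) :
    φ (v + w) u = φ v (w + u) * φ v w * φ w u * (-1) ^ wt (v.1 * w.1 * u.1)

theorem wt_add (v w : Fin m → ZMod 2) : wt (v + w) + 2 * wt (v * w) = wt v + wt w := by
  simp only [wt, hammingNorm, Finset.card_filter, Finset.mul_sum, ← Finset.sum_add_distrib]
  refine Finset.sum_congr rfl fun i _ => ?_
  have key : ∀ a b : ZMod 2, ((if a + b ≠ 0 then 1 else 0) + 2 * if a * b ≠ 0 then 1 else 0) =
      (if a ≠ 0 then 1 else 0) + if b ≠ 0 then 1 else 0 := by decide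
  exact key (v i) (w i)

theorem self_mul (v : Fin m → ZMod 2) : v * v = v := by
  funext i
  simp only [Pi.mul_apply]
  generalize v i = a
  revert a
  decide

theorem add_self_code {V : Submodule (ZMod 2) (Fin m → ZMod 2)} (v : V) : v + v = 0 := by
  ext i
  simpa using CharTwo.add_self_eq_zero (v.1 i)

theorem IsDoublyEven.neg_one_pow {V : Submodule (ZMod 2) (Fin m → ZMod 2)} (hV : IsDoublyEven V)
    (v w : V) : (-1 : ℤˣ) ^ wt (v.1 * w.1) = 1 := by
  have h1 := hV _ v.2
  have h2 := hV _ w.2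
  have h3 := hV _ (v + w).2
  have h4 := wt_add v.1 w.1
  simp only [Submodule.coe_add] at h3
  exact Even.neg_one_pow (by rw [even_iff_two_dvd]; omega)

/-- The code loop `L(V) = {1, -1} × V` of a doubly even code `V` with factor set `φ`. -/
@[ext] structure CodeLoop {V : Submodule (ZMod 2) (Fin m → ZMod 2)} (hV : IsDoublyEven V)
    {φ : V → V → ℤˣ} (hφ : IsFactorSet V φ) where
  sign : ℤˣ
  vec : V

namespace CodeLoop

variable {V : Submodule (ZMod 2) (Fin m → ZMod 2)} {hV : IsDoublyEven V}
  {φ : V → V → ℤˣ} {hφ : IsFactorSet V φ}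

/-- `(s, v) (t, w) = (s t φ(v, w), v + w)`. -/
instance : Mul (CodeLoop hV hφ) := ⟨fun a b => ⟨a.sign * b.sign * φ a.vec b.vec, a.vec + b.vec⟩⟩

instance : One (CodeLoop hV hφ) := ⟨⟨1, 0⟩⟩

instance : Inv (CodeLoop hV hφ) := ⟨fun a => ⟨a.sign * φ a.vec a.vec, a.vec⟩⟩

@[simp] theorem mul_sign (a b : CodeLoop hV hφ) :
    (a * b).sign = a.sign * b.sign * φ a.vec b.vec := rfl
@[simp] theorem mul_vec (a b : CodeLoop hV hφ) : (a * b).vec = a.vec + b.vec := rfl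
@[simp] theorem one_sign : (1 : CodeLoop hV hφ).sign = 1 := rfl
@[simp] theorem one_vec : (1 : CodeLoop hV hφ).vec = 0 := rfl
@[simp] theorem inv_sign (a : CodeLoop hV hφ) : (a⁻¹).sign = a.sign * φ a.vec a.vec := rfl
@[simp] theorem inv_vec (a : CodeLoop hV hφ) : (a⁻¹).vec = a.vec := rfl

theorem unit_cancel (s t : ℤˣ) : s * (s * t) = t := by
  rw [← mul_assoc, Int.units_mul_self, one_mul]

instance : MoufangLoop (CodeLoop hV hφ) where
  one_mul a := by ext1 <;> simp [hφ.zero_left]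
  mul_one a := by ext1 <;> simp [hφ.zero_right]
  inv_mul_cancel_left a b := by
    have h := hφ.cocycle a.vec a.vec b.vec
    rw [add_self_code, hφ.zero_left, self_mul, hV.neg_one_pow, mul_one] at h
    ext1
    · simp only [mul_sign, inv_sign, inv_vec, mul_vec]
      calc _ = (a.sign * a.sign) * b.sign * (φ a.vec (a.vec + b.vec) * φ a.vec a.vec *
            φ a.vec b.vec) := by simp only [mul_comm, mul_left_comm, mul_assoc]
        _ = _ := by rw [← h, Int.units_mul_self]; simp
    · simp [← add_assoc, add_self_code]
  mul_inv_cancel_right b a := by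
    have h := hφ.cocycle b.vec a.vec a.vec
    rw [add_self_code, hφ.zero_right, mul_assoc b.vec.1, self_mul, hV.neg_one_pow, mul_one,
      one_mul] at h
    ext1
    · simp only [mul_sign, inv_sign, inv_vec, mul_vec]
      rw [h]
      simp [mul_comm, mul_left_comm, unit_cancel, Int.units_mul_self]
    · simp [add_assoc, add_self_code]
  moufang a b c := by
    have e1 : (c.vec + a.vec) + c.vec = a.vec := by
      rw [add_comm c.vec, add_assoc, add_self_code, add_zero]
    have e2 : c.vec + (a.vec + c.vec) = a.vec := by rw [← add_assoc, e1]
    have h1 := hφ.cocycle c.vec a.vec c.vec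
    have h2 := hφ.cocycle a.vec c.vec b.vec
    have h3 := hφ.cocycle c.vec (a.vec + c.vec) b.vec
    rw [mul_right_comm c.vec.1, self_mul, hV.neg_one_pow, mul_one] at h1
    have h4 : (-1 : ℤˣ) ^ wt (c.vec.1 * (a.vec + c.vec).1 * b.vec.1) =
        (-1) ^ wt (a.vec.1 * c.vec.1 * b.vec.1) := by
      have h5 := wt_add (a.vec.1 * c.vec.1 * b.vec.1) (c.vec.1 * b.vec.1)
      have h6 : a.vec.1 * c.vec.1 * b.vec.1 + c.vec.1 * b.vec.1 =
          c.vec.1 * (a.vec + c.vec).1 * b.vec.1 := by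
        rw [Submodule.coe_add, mul_add, self_mul, add_mul, mul_comm c.vec.1 a.vec.1]
      rw [h6] at h5
      have h7 := hV.neg_one_pow c.vec b.vec
      have h8 := congrArg (fun k => (-1 : ℤˣ) ^ k) h5
      simpa [pow_add, pow_mul, h7] using h8
    rw [e2, h4] at h3
    ext1
    · simp only [mul_sign, mul_vec]
      rw [e1, h1]
      have h9 : a.vec + (c.vec + b.vec) = a.vec + c.vec + b.vec := by rw [add_assoc]
      rw [h9]
      set s : ℤˣ := (-1) ^ wt (a.vec.1 * c.vec.1 * b.vec.1)
      rw [h3, h2]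
      simp [mul_comm, mul_left_comm, mul_assoc, unit_cancel]
    · simp only [mul_vec]
      rw [e1, add_left_comm a.vec, ← add_assoc, add_self_code, zero_add]

end CodeLoop

/-- `L` is a code loop of rank `n`: it is isomorphic to `L(V)` for a doubly even code `V`
of dimension `n`. -/
def IsCodeLoopOfRank (L : Type*) [MoufangLoop L] (n : ℕ) : Prop :=
  ∃ (m : ℕ) (V : Submodule (ZMod 2) (Fin m → ZMod 2)) (hV : IsDoublyEven V)
    (φ : V → V → ℤˣ) (hφ : IsFactorSet V φ),
    Module.finrank (ZMod 2) V = n ∧ Nonempty (L ≃* CodeLoop hV hφ)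

/-- The doubly even code `V ⊆ 𝔽₂^m` is a representation (of degree `m`) of the loop `L`. -/
def IsRepresentation (L : Type*) [MoufangLoop L]
    (V : Submodule (ZMod 2) (Fin m → ZMod 2)) : Prop :=
  ∃ (hV : IsDoublyEven V) (φ : V → V → ℤˣ) (hφ : IsFactorSet V φ),
    Nonempty (L ≃* CodeLoop hV hφ)

open Classical in
/-- The equivalence class of the coordinate `i`: all `j` lying in exactly the same codewords
as `i` (equivalently, in the same members of any spanning family). -/
noncomputable def coordClass (V : Submodule (ZMod 2) (Fin m → ZMod 2)) (i : Fin m) :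
    Finset (Fin m) :=
  Finset.univ.filter fun j => ∀ v ∈ V, v i = 1 ↔ v j = 1

/-- The set of equivalence classes of coordinates. -/
noncomputable def coordClasses (V : Submodule (ZMod 2) (Fin m → ZMod 2)) :
    Finset (Finset (Fin m)) :=
  Finset.univ.image (coordClass V)

/-- A code is reduced if every equivalence class has fewer than 8 elements. -/
def IsReduced (V : Submodule (ZMod 2) (Fin m → ZMod 2)) : Prop :=
  ∀ X ∈ coordClasses V, X.card < 8

/-- The type of a code: the sizes of the equivalence classes in increasing order. -/
noncomputable def codeType (V : Submodule (ZMod 2) (Fin m → ZMod 2)) : List ℕ :=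
  ((coordClasses V).val.map Finset.card).sort (· ≤ ·)

/-- A reduced representation of `L` is minimal if no representation of `L` has smaller degree. -/
structure IsMinimalRepresentation (L : Type*) [MoufangLoop L]
    (V : Submodule (ZMod 2) (Fin m → ZMod 2)) : Prop where
  isRepresentation : IsRepresentation L V
  isReduced : IsReduced V
  le_degree (n : ℕ) (W : Submodule (ZMod 2) (Fin n → ZMod 2)) : IsRepresentation L W → m ≤ n

end Codes

/-- `(a, b, c, d) = (x 0, x 1, x 2, x 3)` generates `L`, the associators satisfy `(a, b, c) = -1`
and `(a, b, d) = (a, c, d) = (b, c, d) = 1`, and the squares and commutators of the generators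
are given by the vector `l = (λ₁ … λ₁₀)`. -/
def HasCharacteristicVector {L : Type*} [MoufangLoop L] (x : Fin 4 → L) (l : Fin 10 → ZMod 2) :
    Prop :=
  Generates (Set.range x) ∧ ∃ z : L, IsNegOne z ∧
    (x 0 * x 0 = negOnePow z (l 0) ∧ x 1 * x 1 = negOnePow z (l 1) ∧
      x 2 * x 2 = negOnePow z (l 2) ∧ x 3 * x 3 = negOnePow z (l 3)) ∧
    (commutator (x 0) (x 1) = negOnePow z (l 4) ∧ commutator (x 0) (x 2) = negOnePow z (l 5) ∧
      commutator (x 0) (x 3) = negOnePow z (l 6) ∧ commutator (x 1) (x 2) = negOnePow z (l 7) ∧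
      commutator (x 1) (x 3) = negOnePow z (l 8) ∧ commutator (x 2) (x 3) = negOnePow z (l 9)) ∧
    (associator (x 0) (x 1) (x 2) = z ∧ associator (x 0) (x 1) (x 3) = 1 ∧
      associator (x 0) (x 2) (x 3) = 1 ∧ associator (x 1) (x 2) (x 3) = 1)

/-- The characteristic vectors of the sixteen nonassociative code loops of rank 4. -/
def charVector : Fin 16 → Fin 10 → ZMod 2 :=
  ![![1, 1, 1, 0, 1, 1, 0, 1, 0, 0],
    ![0, 0, 0, 0, 0, 0, 0, 0, 0, 0],
    ![0, 0, 0, 0, 1, 1, 0, 1, 0, 0],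
    ![0, 0, 1, 0, 1, 0, 0, 0, 0, 0],
    ![0, 0, 0, 0, 0, 1, 0, 1, 0, 0],
    ![1, 1, 1, 1, 1, 1, 0, 1, 0, 0],
    ![0, 0, 0, 1, 0, 0, 0, 0, 0, 0],
    ![0, 0, 0, 0, 0, 0, 1, 0, 0, 0],
    ![0, 1, 0, 0, 0, 0, 1, 0, 0, 0],
    ![0, 0, 0, 1, 1, 1, 1, 0, 0, 0],
    ![0, 0, 0, 1, 0, 0, 1, 0, 0, 0],
    ![0, 0, 0, 0, 0, 0, 1, 1, 0, 0],
    ![0, 1, 1, 0, 1, 1, 1, 1, 0, 0],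
    ![0, 0, 0, 1, 0, 0, 1, 1, 0, 0],
    ![1, 0, 0, 1, 0, 0, 1, 1, 0, 0],
    ![0, 0, 0, 1, 1, 1, 1, 1, 0, 0]]

/-- The loop `L` is (a copy of) the code loop of rank 4 numbered `i` (from `0` to `15`): the code
loop of rank 4 with the `i`-th characteristic vector for some ordered generating set. -/
def IsLoopC4 (i : Fin 16) (L : Type*) [MoufangLoop L] : Prop :=
  IsCodeLoopOfRank L 4 ∧ ∃ x : Fin 4 → L, HasCharacteristicVector x (charVector i)

/-- The degrees in the table. -/
def tableDegree : Fin 16 → ℕ :=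
  ![8, 14, 12, 18, 18, 11, 17, 17, 19, 19, 17, 17, 17, 13, 17, 17]

/-- The types in the table. -/
def tableType : Fin 16 → List ℕ :=
  ![[1, 1, 1, 1, 1, 1, 1, 1],
    [1, 1, 1, 1, 1, 1, 1, 1, 2, 2, 2],
    [1, 1, 1, 1, 1, 1, 1, 1, 4],
    [1, 1, 1, 1, 1, 1, 1, 1, 2, 2, 6],
    [1, 1, 1, 1, 1, 1, 1, 1, 2, 2, 2, 4],
    [1, 1, 1, 1, 1, 1, 1, 4],
    [1, 1, 1, 1, 3, 3, 3, 4],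
    [1, 1, 1, 1, 1, 1, 2, 2, 2, 2, 3],
    [1, 1, 1, 1, 1, 2, 2, 2, 2, 3, 3],
    [1, 1, 1, 2, 2, 3, 3, 3, 3],
    [1, 1, 1, 1, 2, 2, 3, 3, 3],
    [1, 1, 1, 1, 1, 1, 2, 2, 3, 4],
    [1, 1, 1, 1, 1, 1, 2, 3, 6],
    [1, 1, 1, 1, 1, 1, 2, 2, 3],
    [1, 1, 1, 1, 1, 1, 2, 2, 7],
    [1, 1, 1, 1, 1, 2, 2, 3, 5]]

end CodeLoops

/-! In a code loop $L(V)$ squares, commutators and associators are the signs with exponents $|v|/4$,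
$|v\cap w|/2$ and $|v\cap w\cap u|$. An isomorphism $L\cong L(V)$ therefore turns the generators
$a,b,c,d$ into four words spanning $V$ whose weights, pairwise and triple intersections have
residues modulo 8, 4 and 2 prescribed by $\lambda$ (`HasWeights`). Conversely, inclusion-exclusion
shows that these residues fix the weight modulo 8 of every codeword, as four times a cubic form in
its coordinates, and weights modulo 8 fix the loop (`HasWeights.isRepresentation`). So the
representations of $L$ are the codes spanned by four independent words satisfying the congruences.

The congruences depend only on the multiplicities $t_s$ of the 16 possible columns $s\in\mathbb
F_2^4$. The degree is $\sum t_s$, and the type is the sorted list of the nonzero $t_s$, so an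
integer minimization remains. The residues modulo 4 of the $t_s$ with $s\ne0$ depend on six free
bits. Once they are fixed, $t=r+4u$ for $s\ne0$, and the conditions modulo 8 prescribe only the sum
in $\mathbb F_2^4$ of the columns counted by $u$. Hence $u$ adds nothing or at least 4 to the
degree, and equality determines $u$ (`HasWeightSums.le_total`). The 64 residue systems for each
$\lambda$ are checked by computation (`isAdmissible_charVector`).

For existence, explicit words attain the bound, and polarizing the cubic form gives a factor set on
their span (`HasWeights.isFactorSet`). -/

namespace CodeLoops

/-! ### Column multiplicities and the weight congruences -/

section Columns

variable {m : ℕ}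

/-- The weights modulo 8, 4 and 2 of a family of four words and of its intersections, as
prescribed by a characteristic vector. -/
structure HasWeights (v : Fin 4 → Fin m → ZMod 2) (l : Fin 10 → ZMod 2) : Prop where
  wt_0 : wt (v 0) % 8 = 4 * (l 0).val
  wt_1 : wt (v 1) % 8 = 4 * (l 1).val
  wt_2 : wt (v 2) % 8 = 4 * (l 2).val
  wt_3 : wt (v 3) % 8 = 4 * (l 3).val
  wt_01 : wt (v 0 * v 1) % 4 = 2 * (l 4).val
  wt_02 : wt (v 0 * v 2) % 4 = 2 * (l 5).val
  wt_03 : wt (v 0 * v 3) % 4 = 2 * (l 6).val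
  wt_12 : wt (v 1 * v 2) % 4 = 2 * (l 7).val
  wt_13 : wt (v 1 * v 3) % 4 = 2 * (l 8).val
  wt_23 : wt (v 2 * v 3) % 4 = 2 * (l 9).val
  wt_012 : wt (v 0 * v 1 * v 2) % 2 = 1
  wt_013 : wt (v 0 * v 1 * v 3) % 2 = 0
  wt_023 : wt (v 0 * v 2 * v 3) % 2 = 0
  wt_123 : wt (v 1 * v 2 * v 3) % 2 = 0

instance (v : Fin 4 → Fin m → ZMod 2) (l : Fin 10 → ZMod 2) : Decidable (HasWeights v l) :=
  decidable_of_iff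
    ((wt (v 0) % 8 = 4 * (l 0).val ∧ wt (v 1) % 8 = 4 * (l 1).val ∧
      wt (v 2) % 8 = 4 * (l 2).val ∧ wt (v 3) % 8 = 4 * (l 3).val) ∧
      (wt (v 0 * v 1) % 4 = 2 * (l 4).val ∧ wt (v 0 * v 2) % 4 = 2 * (l 5).val ∧
      wt (v 0 * v 3) % 4 = 2 * (l 6).val ∧ wt (v 1 * v 2) % 4 = 2 * (l 7).val ∧
      wt (v 1 * v 3) % 4 = 2 * (l 8).val ∧ wt (v 2 * v 3) % 4 = 2 * (l 9).val) ∧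
      wt (v 0 * v 1 * v 2) % 2 = 1 ∧ wt (v 0 * v 1 * v 3) % 2 = 0 ∧
      wt (v 0 * v 2 * v 3) % 2 = 0 ∧ wt (v 1 * v 2 * v 3) % 2 = 0)
    ⟨fun ⟨⟨a, b, c, d⟩, ⟨e, f, g, h, i, j⟩, p, q, r, s⟩ =>
      ⟨a, b, c, d, e, f, g, h, i, j, p, q, r, s⟩,
     fun ⟨a, b, c, d, e, f, g, h, i, j, p, q, r, s⟩ =>
      ⟨⟨a, b, c, d⟩, ⟨e, f, g, h, i, j⟩, p, q, r, s⟩⟩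

/-- The number whose binary digits are `a`, `b`, `c`, `d`. -/
def ofBits (a b c d : ZMod 2) : Fin 16 :=
  Fin.ofNat 16 (a.val + 2 * b.val + 4 * c.val + 8 * d.val)

/-- The `j`-th column of a family of four words, read as a binary number. -/
def column (v : Fin 4 → Fin m → ZMod 2) (j : Fin m) : Fin 16 :=
  ofBits (v 0 j) (v 1 j) (v 2 j) (v 3 j)

/-- The number of occurrences of a column. -/
def mult (v : Fin 4 → Fin m → ZMod 2) (s : Fin 16) : ℕ :=
  (Finset.univ.filter fun j => column v j = s).card

theorem testBit_ofBits (a b c d : ZMod 2) :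
    ((ofBits a b c d).val.testBit 0 = true ↔ a ≠ 0) ∧
    ((ofBits a b c d).val.testBit 1 = true ↔ b ≠ 0) ∧
    ((ofBits a b c d).val.testBit 2 = true ↔ c ≠ 0) ∧
    ((ofBits a b c d).val.testBit 3 = true ↔ d ≠ 0) := by
  revert a b c d
  decide

theorem testBit_column (v : Fin 4 → Fin m → ZMod 2) (j : Fin m) (k : Fin 4) :
    (column v j).val.testBit k.val = true ↔ v k j ≠ 0 := by
  have h := testBit_ofBits (v 0 j) (v 1 j) (v 2 j) (v 3 j)
  fin_cases k
  exacts [h.1, h.2.1, h.2.2.1, h.2.2.2]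

theorem column_eq_iff (v : Fin 4 → Fin m → ZMod 2) (i j : Fin m) :
    column v i = column v j ↔ ∀ k, v k i = v k j := by
  constructor
  · intro h k
    have h1 := testBit_column v i k
    rw [h, testBit_column] at h1
    generalize v k i = a, v k j = b at h1
    revert a b
    decide
  · intro h
    simp only [column, h]

theorem sum_fin_sixteen (f : Fin 16 → ℕ) :
    ∑ s, f s = f 0 + f 1 + f 2 + f 3 + f 4 + f 5 + f 6 + f 7 + f 8 + f 9 + f 10 + f 11 + f 12 +
      f 13 + f 14 + f 15 := by
  simp only [Fin.sum_univ_castSucc, Finset.univ_eq_empty, Finset.sum_empty, zero_add]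
  rfl

/-- Every weight that occurs counts the coordinates whose column has certain bits set; grouping the
coordinates by column makes it a sum of multiplicities. -/
theorem card_filter_column (v : Fin 4 → Fin m → ZMod 2) (p : Fin 16 → Bool) :
    (Finset.univ.filter fun j => p (column v j) = true).card =
      ∑ s, if p s then mult v s else 0 := by
  rw [Finset.card_eq_sum_card_fiberwise (f := column v) (t := Finset.univ) (by simp)]
  refine Finset.sum_congr rfl fun s _ => ?_
  rw [Finset.filter_filter]
  split_ifs with h
  · refine congrArg Finset.card (Finset.filter_congr fun j _ => ?_)
    constructor
    · exact fun h => h.2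
    · rintro rfl
      exact ⟨h, rfl⟩
  · rw [Finset.card_eq_zero, Finset.filter_eq_empty_iff]
    rintro j _ ⟨h1, rfl⟩
    exact h h1

theorem sum_mult (v : Fin 4 → Fin m → ZMod 2) : ∑ s, mult v s = m := by
  have h := card_filter_column v fun _ => true
  simpa using h.symm

theorem wt_eq_sum_mult (v : Fin 4 → Fin m → ZMod 2) (k : Fin 4) :
    wt (v k) = ∑ s : Fin 16, if s.val.testBit k.val then mult v s else 0 := by
  rw [← card_filter_column v fun s => s.val.testBit k.val]
  rw [wt, hammingNorm]
  exact congrArg Finset.card (Finset.filter_congr fun j _ => (testBit_column v j k).symm)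

theorem wt_mul_eq_sum_mult (v : Fin 4 → Fin m → ZMod 2) (k k' : Fin 4) :
    wt (v k * v k') =
      ∑ s : Fin 16, if s.val.testBit k.val && s.val.testBit k'.val then mult v s else 0 := by
  rw [← card_filter_column v fun s => s.val.testBit k.val && s.val.testBit k'.val]
  rw [wt, hammingNorm]
  refine congrArg Finset.card (Finset.filter_congr fun j _ => ?_)
  rw [Bool.and_eq_true, testBit_column, testBit_column, Pi.mul_apply, mul_ne_zero_iff]

theorem wt_mul_mul_eq_sum_mult (v : Fin 4 → Fin m → ZMod 2) (k k' k'' : Fin 4) :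
    wt (v k * v k' * v k'') =
      ∑ s : Fin 16, if s.val.testBit k.val && s.val.testBit k'.val && s.val.testBit k''.val
        then mult v s else 0 := by
  rw [← card_filter_column v fun s =>
    s.val.testBit k.val && s.val.testBit k'.val && s.val.testBit k''.val]
  rw [wt, hammingNorm]
  refine congrArg Finset.card (Finset.filter_congr fun j _ => ?_)
  rw [Bool.and_eq_true, Bool.and_eq_true, testBit_column, testBit_column, testBit_column,
    Pi.mul_apply, Pi.mul_apply, mul_ne_zero_iff, mul_ne_zero_iff]

/-- The congruences for the multiplicities of the columns that amount to `HasWeights`. -/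
structure HasWeightSums (t : Fin 16 → ℕ) (l : Fin 10 → ℕ) : Prop where
  sum_0 : (t 1 + t 3 + t 5 + t 7 + t 9 + t 11 + t 13 + t 15) % 8 = 4 * l 0
  sum_1 : (t 2 + t 3 + t 6 + t 7 + t 10 + t 11 + t 14 + t 15) % 8 = 4 * l 1
  sum_2 : (t 4 + t 5 + t 6 + t 7 + t 12 + t 13 + t 14 + t 15) % 8 = 4 * l 2
  sum_3 : (t 8 + t 9 + t 10 + t 11 + t 12 + t 13 + t 14 + t 15) % 8 = 4 * l 3
  sum_01 : (t 3 + t 7 + t 11 + t 15) % 4 = 2 * l 4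
  sum_02 : (t 5 + t 7 + t 13 + t 15) % 4 = 2 * l 5
  sum_03 : (t 9 + t 11 + t 13 + t 15) % 4 = 2 * l 6
  sum_12 : (t 6 + t 7 + t 14 + t 15) % 4 = 2 * l 7
  sum_13 : (t 10 + t 11 + t 14 + t 15) % 4 = 2 * l 8
  sum_23 : (t 12 + t 13 + t 14 + t 15) % 4 = 2 * l 9
  sum_012 : (t 7 + t 15) % 2 = 1
  sum_013 : (t 11 + t 15) % 2 = 0
  sum_023 : (t 13 + t 15) % 2 = 0
  sum_123 : (t 14 + t 15) % 2 = 0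

theorem HasWeights.hasWeightSums {v : Fin 4 → Fin m → ZMod 2} {l : Fin 10 → ZMod 2}
    (h : HasWeights v l) : HasWeightSums (mult v) fun k => (l k).val := by
  obtain ⟨h0, h1, h2, h3, h01, h02, h03, h12, h13, h23, h012, h013, h023, h123⟩ := h
  rw [wt_eq_sum_mult, sum_fin_sixteen] at h0 h1 h2 h3
  rw [wt_mul_eq_sum_mult, sum_fin_sixteen] at h01 h02 h03 h12 h13 h23
  rw [wt_mul_mul_eq_sum_mult, sum_fin_sixteen] at h012 h013 h023 h123
  simp [Nat.testBit, Nat.shiftRight_eq_div_pow] at h0 h1 h2 h3 h01 h02 h03 h12 h13 h23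
  simp [Nat.testBit, Nat.shiftRight_eq_div_pow] at h012 h013 h023 h123
  exact ⟨h0, h1, h2, h3, h01, h02, h03, h12, h13, h23, h012, h013, h023, h123⟩

/-- The congruences alone allow $v_3=0$ when $\lambda_4,\lambda_7,\lambda_9,\lambda_{10}$ vanish.
This is the only consequence of linear independence that the lower bound needs. -/
theorem exists_mult_ne_zero {v : Fin 4 → Fin m → ZMod 2} (h : v 3 ≠ 0) :
    mult v 8 + mult v 9 + mult v 10 + mult v 11 + mult v 12 + mult v 13 + mult v 14 +
      mult v 15 ≠ 0 := by
  have h1 : wt (v 3) ≠ 0 := by simpa [wt] using h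
  rw [wt_eq_sum_mult, sum_fin_sixteen] at h1
  simp [Nat.testBit, Nat.shiftRight_eq_div_pow] at h1
  omega

end Columns

/-! ### The type of a code read off from multiplicities -/

section Types

variable {m : ℕ}

theorem coordClass_eq {V : Submodule (ZMod 2) (Fin m → ZMod 2)} {v : Fin 4 → Fin m → ZMod 2}
    (hv : Submodule.span (ZMod 2) (Set.range v) = V) (i : Fin m) :
    coordClass V i = Finset.univ.filter fun j => column v j = column v i := by
  classical
  ext j
  simp only [coordClass, Finset.mem_filter, Finset.mem_univ, true_and]
  rw [column_eq_iff]
  have key : ∀ a b : ZMod 2, (a = 1 ↔ b = 1) → b = a := by decide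
  constructor
  · intro h k
    exact key _ _ (h (v k) (hv ▸ Submodule.subset_span ⟨k, rfl⟩))
  · intro h w hw
    have h1 : w i = w j := by
      rw [← hv] at hw
      induction hw using Submodule.span_induction with
      | mem x hx =>
        obtain ⟨k, rfl⟩ := hx
        exact (h k).symm
      | zero => rfl
      | add x y _ _ hx hy => simp [hx, hy]
      | smul a x _ hx => simp [hx]
    rw [h1]

/-- Coordinates agreeing on the four spanning words agree on all of $V$, so the equivalence classes
are the nonempty fibres of `column`. -/
theorem map_card_coordClasses {V : Submodule (ZMod 2) (Fin m → ZMod 2)}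
    {v : Fin 4 → Fin m → ZMod 2} (hv : Submodule.span (ZMod 2) (Set.range v) = V) :
    (coordClasses V).val.map Finset.card =
      ((Finset.univ.filter fun s => mult v s ≠ 0).val.map (mult v)) := by
  classical
  set F : Fin 16 → Finset (Fin m) := fun s => Finset.univ.filter fun j => column v j = s with hF
  have h1 : coordClasses V = (Finset.univ.filter fun s => mult v s ≠ 0).image F := by
    ext X
    simp only [coordClasses, Finset.mem_image, Finset.mem_univ, true_and, Finset.mem_filter]
    constructor
    · rintro ⟨i, rfl⟩
      refine ⟨column v i, ?_, (coordClass_eq hv i).symm⟩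
      rw [mult, Finset.card_ne_zero]
      exact ⟨i, by simp⟩
    · rintro ⟨s, hs, rfl⟩
      rw [mult, Finset.card_ne_zero] at hs
      obtain ⟨i, hi⟩ := hs
      simp only [Finset.mem_filter, Finset.mem_univ, true_and] at hi
      refine ⟨i, ?_⟩
      rw [coordClass_eq hv, hi]
  rw [h1, Finset.image_val_of_injOn, Multiset.map_map]
  · rfl
  -- Distinct columns have disjoint fibres, so nonempty fibres are distinct and no class size is
  -- lost in passing to the image.
  · intro s hs s' _ h
    simp only [Finset.coe_filter, Finset.mem_univ, true_and, Set.mem_ofPred_eq] at hs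
    rw [mult, Finset.card_ne_zero] at hs
    obtain ⟨i, hi⟩ := hs
    have hi' : i ∈ F s' := h ▸ hi
    simp only [hF, Finset.mem_filter, Finset.mem_univ, true_and] at hi hi'
    rw [← hi, hi']

theorem codeType_eq_of_perm {V : Submodule (ZMod 2) (Fin m → ZMod 2)}
    {v : Fin 4 → Fin m → ZMod 2} (hv : Submodule.span (ZMod 2) (Set.range v) = V) {L : List ℕ}
    (hL : L.Pairwise (· ≤ ·))
    (h : (((List.finRange 16).map (mult v)).filter (· ≠ 0)).Perm L) : codeType V = L := by
  have h1 : (Finset.univ.filter fun s => mult v s ≠ 0).val.map (mult v) = (L : Multiset ℕ) := by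
    rw [← Multiset.coe_eq_coe.2 h, ← Multiset.filter_coe, ← Multiset.map_coe,
      Multiset.filter_map]
    rfl
  rw [codeType, map_card_coordClasses hv, h1, Multiset.coe_sort]
  exact List.mergeSort_eq_self (r := (· ≤ ·)) (hL.imp (by simp))

theorem isReduced_of_codeType {V : Submodule (ZMod 2) (Fin m → ZMod 2)}
    (h : ∀ n ∈ codeType V, n < 8) : IsReduced V := by
  intro X hX
  refine h _ ?_
  rw [codeType, Multiset.mem_sort]
  exact Multiset.mem_map_of_mem _ hX

end Types

/-! ### The lower bound for the degree -/

section LowerBound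

/-- The residues modulo 4 of the multiplicities of the nonzero columns, as determined by the
five of them that belong to columns with at least three ones. -/
def residue (l : Fin 10 → ℕ) (a b c d e : ℕ) : Fin 16 → ℕ :=
  let r7 := (a + 1) % 2 + 2 * b
  let r11 := a % 2 + 2 * c
  let r13 := a % 2 + 2 * d
  let r14 := a % 2 + 2 * e
  let r3 := (2 * l 4 + 3 * (r7 + r11 + a)) % 4
  let r5 := (2 * l 5 + 3 * (r7 + r13 + a)) % 4
  let r9 := (2 * l 6 + 3 * (r11 + r13 + a)) % 4
  let r6 := (2 * l 7 + 3 * (r7 + r14 + a)) % 4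
  let r10 := (2 * l 8 + 3 * (r11 + r14 + a)) % 4
  let r12 := (2 * l 9 + 3 * (r13 + r14 + a)) % 4
  let r1 := 3 * (r3 + r5 + r7 + r9 + r11 + r13 + a) % 4
  let r2 := 3 * (r3 + r6 + r7 + r10 + r11 + r14 + a) % 4
  let r4 := 3 * (r5 + r6 + r7 + r12 + r13 + r14 + a) % 4
  let r8 := 3 * (r9 + r10 + r11 + r12 + r13 + r14 + a) % 4
  ![0, r1, r2, r3, r4, r5, r6, r7, r8, r9, r10, r11, r12, r13, r14, a]

/-- The column that has to be added four times to a system of residues to meet the conditions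
modulo 8. -/
def defect (l : Fin 10 → ℕ) (r : Fin 16 → ℕ) : Fin 16 :=
  Fin.ofNat 16 ((4 * l 0 + 7 * (r 1 + r 3 + r 5 + r 7 + r 9 + r 11 + r 13 + r 15)) % 8 / 4 +
    2 * ((4 * l 1 + 7 * (r 2 + r 3 + r 6 + r 7 + r 10 + r 11 + r 14 + r 15)) % 8 / 4) +
    4 * ((4 * l 2 + 7 * (r 4 + r 5 + r 6 + r 7 + r 12 + r 13 + r 14 + r 15)) % 8 / 4) +
    8 * ((4 * l 3 + 7 * (r 8 + r 9 + r 10 + r 11 + r 12 + r 13 + r 14 + r 15)) % 8 / 4))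

/-- The sum of all entries. -/
def total (r : Fin 16 → ℕ) : ℕ :=
  r 0 + r 1 + r 2 + r 3 + r 4 + r 5 + r 6 + r 7 + r 8 + r 9 + r 10 + r 11 + r 12 + r 13 + r 14 +
    r 15

/-- The system of residues `r` leads to no code of degree less than `n`, and only to codes of
type `L` in degree `n`. -/
def Admissible (l : Fin 10 → ℕ) (n : ℕ) (L : List ℕ) (r : Fin 16 → ℕ) : Prop :=
  n < total r + (if defect l r = 0 then 0 else 4) ∨
    (n = total r + (if defect l r = 0 then 0 else 4) ∧
      (((List.finRange 16).map fun s =>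
        r s + if defect l r ≠ 0 ∧ s = defect l r then 4 else 0).filter (· ≠ 0)).Perm L) ∨
    (l 3 = 0 ∧ r 8 + r 9 + r 10 + r 11 + r 12 + r 13 + r 14 + r 15 = 0 ∧ n < total r + 8)

instance (l : Fin 10 → ℕ) (n : ℕ) (L : List ℕ) (r : Fin 16 → ℕ) :
    Decidable (Admissible l n L r) :=
  inferInstanceAs (Decidable (_ ∨ _ ∨ _))

/-- A residue modulo 4 consists of two binary digits. A triple intersection fixes the lower digit in
terms of $t_{15}$; the upper one stays free. -/
theorem parity_digit {x y : ℕ} (h : (x + y) % 2 = 0) : y % 4 % 2 + 2 * (x % 4 / 2) = x % 4 := by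
  omega

theorem parity_digit' {x y : ℕ} (h : (x + y) % 2 = 1) :
    (y % 4 + 1) % 2 + 2 * (x % 4 / 2) = x % 4 := by
  omega

theorem solve_mod_four {x y z w l : ℕ} (h : (x + y + z + w) % 4 = 2 * l) :
    (2 * l + 3 * (y % 4 + z % 4 + w % 4)) % 4 = x % 4 := by
  omega

theorem solve_mod_eight {x a b c d e f g l : ℕ}
    (h : (x + a + b + c + d + e + f + g) % 8 = 4 * l) :
    3 * (a % 4 + b % 4 + c % 4 + d % 4 + e % 4 + f % 4 + g % 4) % 4 = x % 4 := by
  omega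

/-- The system is triangular: triple intersections treat the columns with three ones, pairwise
intersections then give those with two ones, and the weights, used only modulo 4, give those with a
single one. The factor 3 in `residue` stands for $-1$ modulo 4. -/
theorem HasWeightSums.mod_four_eq {t : Fin 16 → ℕ} {l : Fin 10 → ℕ} (h : HasWeightSums t l)
    (s : Fin 16) (hs : s ≠ 0) :
    t s % 4 = residue l (t 15 % 4) (t 7 % 4 / 2) (t 11 % 4 / 2) (t 13 % 4 / 2) (t 14 % 4 / 2) s := by
  simp only [residue, parity_digit' h.sum_012, parity_digit h.sum_013, parity_digit h.sum_023,
    parity_digit h.sum_123, solve_mod_four h.sum_01, solve_mod_four h.sum_02,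
    solve_mod_four h.sum_03, solve_mod_four h.sum_12, solve_mod_four h.sum_13,
    solve_mod_four h.sum_23, solve_mod_eight h.sum_0, solve_mod_eight h.sum_1,
    solve_mod_eight h.sum_2, solve_mod_eight h.sum_3]
  fin_cases s
  · exact absurd rfl hs
  all_goals rfl

theorem eq_single_of_sum_eq_one {u : Fin 16 → ℕ} (h : total u = 1) :
    ∃ s, u = Pi.single s 1 := by
  rw [total, ← sum_fin_sixteen] at h
  obtain ⟨s, -, hs⟩ := Finset.exists_ne_zero_of_sum_ne_zero (h ▸ one_ne_zero)
  refine ⟨s, funext fun s' => ?_⟩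
  rw [← Finset.add_sum_erase _ _ (Finset.mem_univ s)] at h
  have h0 : ∑ x ∈ Finset.univ.erase s, u x = 0 := by omega
  rw [Finset.sum_eq_zero_iff] at h0
  by_cases e : s' = s
  · subst e
    rw [Pi.single_eq_same]
    omega
  · rw [Pi.single_eq_of_ne e, h0 s' (Finset.mem_erase.2 ⟨e, Finset.mem_univ _⟩)]

/-- The sum modulo 2 of the columns with multiplicities `u`. -/
def columnSum (u : Fin 16 → ℕ) : Fin 16 :=
  Fin.ofNat 16 ((u 1 + u 3 + u 5 + u 7 + u 9 + u 11 + u 13 + u 15) % 2 +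
    2 * ((u 2 + u 3 + u 6 + u 7 + u 10 + u 11 + u 14 + u 15) % 2) +
    4 * ((u 4 + u 5 + u 6 + u 7 + u 12 + u 13 + u 14 + u 15) % 2) +
    8 * ((u 8 + u 9 + u 10 + u 11 + u 12 + u 13 + u 14 + u 15) % 2))

theorem columnSum_single (s : Fin 16) : columnSum (Pi.single s 1) = s := by
  revert s
  decide

/-- Substituting $t=r+4u$ leaves $4\sum u\equiv 4\lambda-\sum r \pmod 8$ for each word, and dividing
by 4 gives one bit of the column sum. The factor 7 in `defect` stands for $-1$ modulo 8. -/
theorem columnSum_eq_defect {u r t : Fin 16 → ℕ} {l : Fin 10 → ℕ} (h : HasWeightSums t l)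
    (hl : ∀ k, l k < 2) (hu : ∀ s, s ≠ 0 → t s = r s + 4 * u s) : columnSum u = defect l r := by
  obtain ⟨h0, h1, h2, h3, -⟩ := h
  rw [hu 1 (by decide), hu 3 (by decide), hu 5 (by decide), hu 7 (by decide), hu 9 (by decide),
    hu 11 (by decide), hu 13 (by decide), hu 15 (by decide)] at h0
  rw [hu 2 (by decide), hu 3 (by decide), hu 6 (by decide), hu 7 (by decide), hu 10 (by decide),
    hu 11 (by decide), hu 14 (by decide), hu 15 (by decide)] at h1
  rw [hu 4 (by decide), hu 5 (by decide), hu 6 (by decide), hu 7 (by decide), hu 12 (by decide),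
    hu 13 (by decide), hu 14 (by decide), hu 15 (by decide)] at h2
  rw [hu 8 (by decide), hu 9 (by decide), hu 10 (by decide), hu 11 (by decide),
    hu 12 (by decide), hu 13 (by decide), hu 14 (by decide), hu 15 (by decide)] at h3
  have l0 := hl 0
  have l1 := hl 1
  have l2 := hl 2
  have l3 := hl 3
  rw [columnSum, defect]
  refine congrArg (Fin.ofNat 16) ?_
  congr 1
  · congr 1
    · congr 1 <;> [skip; congr 1] <;> omega
    · congr 1; omega
  · congr 1; omega

/-- Multiplicities satisfying the congruences of an admissible characteristic vector sum up to at
least `n`, and they form the list `L` if the sum is `n`. -/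
theorem HasWeightSums.le_total {t : Fin 16 → ℕ} {l : Fin 10 → ℕ} {n : ℕ} {L : List ℕ}
    (h : HasWeightSums t l) (hl : ∀ k, l k < 2)
    (ht : t 8 + t 9 + t 10 + t 11 + t 12 + t 13 + t 14 + t 15 ≠ 0)
    (hr : ∀ (a : Fin 4) (b c d e : Fin 2), Admissible l n L (residue l a b c d e)) :
    n ≤ total t ∧
      (total t = n → (((List.finRange 16).map t).filter (· ≠ 0)).Perm L) := by
  have hr' := hr ⟨t 15 % 4, by omega⟩ ⟨t 7 % 4 / 2, by omega⟩ ⟨t 11 % 4 / 2, by omega⟩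
    ⟨t 13 % 4 / 2, by omega⟩ ⟨t 14 % 4 / 2, by omega⟩
  have hmod := h.mod_four_eq
  have hr0 : residue l (t 15 % 4) (t 7 % 4 / 2) (t 11 % 4 / 2) (t 13 % 4 / 2) (t 14 % 4 / 2) 0 = 0 :=
    rfl
  dsimp only at hr'
  generalize residue l (t 15 % 4) (t 7 % 4 / 2) (t 11 % 4 / 2) (t 13 % 4 / 2) (t 14 % 4 / 2) = r
    at hr' hmod hr0
  obtain ⟨u, hu0, hu⟩ : ∃ u : Fin 16 → ℕ, u 0 = 0 ∧ ∀ s, s ≠ 0 → t s = r s + 4 * u s := by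
    refine ⟨fun s => if s = 0 then 0 else t s / 4, rfl, fun s hs => ?_⟩
    have := hmod s hs
    simp only [if_neg hs]
    omega
  have hcol := columnSum_eq_defect h hl hu
  have htot : total t = t 0 + total r + 4 * total u := by
    simp only [total, hu 1 (by decide), hu 2 (by decide), hu 3 (by decide), hu 4 (by decide),
      hu 5 (by decide), hu 6 (by decide), hu 7 (by decide), hu 8 (by decide), hu 9 (by decide),
      hu 10 (by decide), hu 11 (by decide), hu 12 (by decide), hu 13 (by decide),
      hu 14 (by decide), hu 15 (by decide), hu0, hr0]
    ring
  have hpos : defect l r ≠ 0 → total u ≠ 0 := by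
    rintro hd h0
    refine hd (hcol ▸ ?_)
    have : u = 0 := by
      rw [total, ← sum_fin_sixteen, Finset.sum_eq_zero_iff] at h0
      exact funext fun s => h0 s (Finset.mem_univ _)
    subst this
    rfl
  have hle : total r + (if defect l r = 0 then 0 else 4) + t 0 ≤ total t := by
    split_ifs with hd
    · omega
    · have := hpos hd
      omega
  rcases hr' with h1 | ⟨h1, h2⟩ | ⟨h1, h2, h3⟩
  · exact ⟨by omega, fun h => by omega⟩
  -- Equality leaves no zero columns and no slack in $u$: either $u=0$, or $u$ is a single column,
  -- which must then be the defect.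
  · refine ⟨by omega, fun h => ?_⟩
    convert h2 using 3
    funext s
    have ht0 : t 0 = 0 := by omega
    have hts : t s = r s + 4 * u s := by
      by_cases hs : s = 0
      · rw [hs, ht0, hr0, hu0]
      · exact hu s hs
    rw [hts]
    congr 1
    by_cases hd : defect l r = 0
    · rw [if_pos hd] at h1
      have h0 : total u = 0 := by omega
      rw [total, ← sum_fin_sixteen, Finset.sum_eq_zero_iff] at h0
      rw [h0 s (Finset.mem_univ _), if_neg (by tauto), mul_zero]
    · rw [if_neg hd] at h1
      obtain ⟨s', hs'⟩ := eq_single_of_sum_eq_one (u := u) (by have := hpos hd; omega)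
      rw [hs', columnSum_single] at hcol
      rw [hs', ← hcol]
      by_cases e : s = s'
      · subst e
        rw [if_pos ⟨by rw [hcol]; exact hd, rfl⟩, Pi.single_eq_same]
      · rw [if_neg (by tauto), Pi.single_eq_of_ne e, mul_zero]
  -- Here $|v_3|=4(u_8+\dots+u_{15})$ is nonzero and divisible by 8, so $u$ has total at least 2 and
  -- the degree grows by at least 8.
  · have h4 := h.sum_3
    have hu8 := hu 8 (by decide)
    have hu9 := hu 9 (by decide)
    have hu10 := hu 10 (by decide)
    have hu11 := hu 11 (by decide)
    have hu12 := hu 12 (by decide)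
    have hu13 := hu 13 (by decide)
    have hu14 := hu 14 (by decide)
    have hu15 := hu 15 (by decide)
    have h5 : 2 ≤ total u := by
      rw [total]
      omega
    exact ⟨by omega, fun h => by omega⟩

/-- Evaluate `f n` after reducing `n` to a numeral. -/
def withValue (n : ℕ) (f : ℕ → Bool) : Bool :=
  match n with
  | 0 => f 0
  | k + 1 => f k.succ

theorem withValue_eq (n : ℕ) (f : ℕ → Bool) : withValue n f = f n := by
  cases n <;> rfl

/-- `Admissible` for a system of residues, arranged for evaluation. -/
def isAdmissible (l : Fin 10 → ℕ) (n : ℕ) (L : List ℕ) (a b c d e : ℕ) : Bool :=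
  withValue ((a + 1) % 2 + 2 * b) fun r7 =>
  withValue (a % 2 + 2 * c) fun r11 =>
  withValue (a % 2 + 2 * d) fun r13 =>
  withValue (a % 2 + 2 * e) fun r14 =>
  withValue ((2 * l 4 + 3 * (r7 + r11 + a)) % 4) fun r3 =>
  withValue ((2 * l 5 + 3 * (r7 + r13 + a)) % 4) fun r5 =>
  withValue ((2 * l 6 + 3 * (r11 + r13 + a)) % 4) fun r9 =>
  withValue ((2 * l 7 + 3 * (r7 + r14 + a)) % 4) fun r6 =>
  withValue ((2 * l 8 + 3 * (r11 + r14 + a)) % 4) fun r10 =>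
  withValue ((2 * l 9 + 3 * (r13 + r14 + a)) % 4) fun r12 =>
  withValue (3 * (r3 + r5 + r7 + r9 + r11 + r13 + a) % 4) fun r1 =>
  withValue (3 * (r3 + r6 + r7 + r10 + r11 + r14 + a) % 4) fun r2 =>
  withValue (3 * (r5 + r6 + r7 + r12 + r13 + r14 + a) % 4) fun r4 =>
  withValue (3 * (r9 + r10 + r11 + r12 + r13 + r14 + a) % 4) fun r8 =>
  -- A cheap sufficient test; the defect is computed only when it fails.
  decide (n < r1 + r2 + r3 + r4 + r5 + r6 + r7 + r8 + r9 + r10 + r11 + r12 + r13 + r14 + a) ||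
  decide (Admissible l n L ![0, r1, r2, r3, r4, r5, r6, r7, r8, r9, r10, r11, r12, r13, r14, a])

theorem admissible_of_isAdmissible {l : Fin 10 → ℕ} {n : ℕ} {L : List ℕ} {a b c d e : ℕ}
    (h : isAdmissible l n L a b c d e = true) : Admissible l n L (residue l a b c d e) := by
  simp only [isAdmissible, withValue_eq, Bool.or_eq_true, decide_eq_true_iff] at h
  rcases h with h | h
  · refine Or.inl (lt_of_lt_of_le h ?_)
    refine le_trans (le_of_eq ?_) (Nat.le_add_right _ _)
    exact congrArg (fun x => x + _ + _ + _ + _ + _ + _ + _ + _ + _ + _ + _ + _ + _ + _)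
      (Nat.zero_add _).symm
  · exact h

/-- The finite heart of the lower bound: 64 residue systems for each of the 16 characteristic
vectors. -/
theorem isAdmissible_charVector (i : Fin 16) (a : Fin 4) (b c d e : Fin 2) :
    isAdmissible (fun k => (charVector i k).val) (tableDegree i) (tableType i) a b c d e := by
  revert i a b c d e
  decide +kernel

theorem admissible_charVector (i : Fin 16) (a : Fin 4) (b c d e : Fin 2) :
    Admissible (fun k => (charVector i k).val) (tableDegree i) (tableType i)
      (residue (fun k => (charVector i k).val) a b c d e) :=
  admissible_of_isAdmissible (isAdmissible_charVector i a b c d e)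

end LowerBound

/-! ### The cubic form and the weights modulo 8 -/

section Weights

variable {m : ℕ}

/-- The cubic form attached to a characteristic vector. -/
def cubicForm (l : Fin 10 → ZMod 2) (x : Fin 4 → ZMod 2) : ZMod 2 :=
  l 0 * x 0 + l 1 * x 1 + l 2 * x 2 + l 3 * x 3 + l 4 * (x 0 * x 1) + l 5 * (x 0 * x 2) +
    l 6 * (x 0 * x 3) + l 7 * (x 1 * x 2) + l 8 * (x 1 * x 3) + l 9 * (x 2 * x 3) +
    x 0 * x 1 * x 2

/-- A bilinear form and a cubic correction term, polarizing `cubicForm`. -/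
def polarForm (l : Fin 10 → ZMod 2) (x y : Fin 4 → ZMod 2) : ZMod 2 :=
  l 0 * (x 0 * y 0) + l 1 * (x 1 * y 1) + l 2 * (x 2 * y 2) + l 3 * (x 3 * y 3) +
    l 4 * (x 0 * y 1) + l 5 * (x 0 * y 2) + l 6 * (x 0 * y 3) + l 7 * (x 1 * y 2) +
    l 8 * (x 1 * y 3) + l 9 * (x 2 * y 3) +
    (x 0 * x 1 * y 2 + x 1 * x 2 * y 0 + x 0 * x 2 * y 1)

theorem mul_self_zmod_two (a : ZMod 2) : a * a = a := by
  revert a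
  decide

/-- This and the next two identities are the factor set axioms in additive form: the cubic form
plays the role of $|v|/4$, and its successive polarizations those of $|v\cap w|/2$ and $|v\cap w\cap
u|$. -/
theorem polarForm_self (l : Fin 10 → ZMod 2) (x : Fin 4 → ZMod 2) :
    polarForm l x x = cubicForm l x := by
  simp only [polarForm, cubicForm, mul_self_zmod_two]
  have h2 : (2 : ZMod 2) = 0 := rfl
  linear_combination (x 0 * x 1 * x 2) * h2

theorem polarForm_swap (l : Fin 10 → ZMod 2) (x y : Fin 4 → ZMod 2) :
    polarForm l x y = cubicForm l (x + y) + cubicForm l x + cubicForm l y + polarForm l y x := by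
  simp only [polarForm, cubicForm, Pi.add_apply]
  grind

theorem polarForm_cocycle (l : Fin 10 → ZMod 2) (x y z : Fin 4 → ZMod 2) :
    polarForm l (x + y) z = polarForm l x (y + z) + polarForm l x y + polarForm l y z +
      (cubicForm l (x + y + z) + cubicForm l (x + y) + cubicForm l (y + z) + cubicForm l (x + z) +
        cubicForm l x + cubicForm l y + cubicForm l z) := by
  simp only [polarForm, cubicForm, Pi.add_apply]
  grind

theorem wt_eq_sum_val (v : Fin m → ZMod 2) : (wt v : ℤ) = ∑ j, ((v j).val : ℤ) := by
  rw [wt, hammingNorm, Finset.card_filter, Nat.cast_sum]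
  refine Finset.sum_congr rfl fun j _ => ?_
  generalize v j = a
  revert a
  decide

/-- Inclusion-exclusion for the parity of four bits. Its coefficients 2, 4, 8 explain why pairs
matter modulo 4, triples modulo 2 and the fourfold intersection not at all. -/
theorem val_linear_combination (x y z w a b c d : ZMod 2) :
    ((x * a + y * b + z * c + w * d).val : ℤ) =
      x.val * a.val + y.val * b.val + z.val * c.val + w.val * d.val -
      2 * ((x * y).val * (a * b).val + (x * z).val * (a * c).val + (x * w).val * (a * d).val +
        (y * z).val * (b * c).val + (y * w).val * (b * d).val + (z * w).val * (c * d).val) +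
      4 * ((x * y * z).val * (a * b * c).val + (x * y * w).val * (a * b * d).val +
        (x * z * w).val * (a * c * d).val + (y * z * w).val * (b * c * d).val) -
      8 * ((x * y * z * w).val * (a * b * c * d).val) := by
  revert x y z w a b c d
  decide +kernel

theorem wt_linear_combination (v : Fin 4 → Fin m → ZMod 2) (x y z w : ZMod 2) :
    (wt (x • v 0 + y • v 1 + z • v 2 + w • v 3) : ℤ) =
      x.val * wt (v 0) + y.val * wt (v 1) + z.val * wt (v 2) + w.val * wt (v 3) -
      2 * ((x * y).val * wt (v 0 * v 1) + (x * z).val * wt (v 0 * v 2) +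
        (x * w).val * wt (v 0 * v 3) + (y * z).val * wt (v 1 * v 2) +
        (y * w).val * wt (v 1 * v 3) + (z * w).val * wt (v 2 * v 3)) +
      4 * ((x * y * z).val * wt (v 0 * v 1 * v 2) + (x * y * w).val * wt (v 0 * v 1 * v 3) +
        (x * z * w).val * wt (v 0 * v 2 * v 3) + (y * z * w).val * wt (v 1 * v 2 * v 3)) -
      8 * ((x * y * z * w).val * wt (v 0 * v 1 * v 2 * v 3)) := by
  simp only [wt_eq_sum_val, Finset.mul_sum, ← Finset.sum_add_distrib, ← Finset.sum_sub_distrib]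
  exact Finset.sum_congr rfl fun j _ => val_linear_combination x y z w _ _ _ _

theorem val_cubicForm (l : Fin 10 → ZMod 2) (x : Fin 4 → ZMod 2) :
    ∃ q : ℤ, ((cubicForm l x).val : ℤ) + 2 * q =
      (l 0).val * (x 0).val + (l 1).val * (x 1).val + (l 2).val * (x 2).val +
      (l 3).val * (x 3).val + (l 4).val * (x 0 * x 1).val + (l 5).val * (x 0 * x 2).val +
      (l 6).val * (x 0 * x 3).val + (l 7).val * (x 1 * x 2).val + (l 8).val * (x 1 * x 3).val +
      (l 9).val * (x 2 * x 3).val + (x 0 * x 1 * x 2).val := by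
  have h : ∀ a : ZMod 2, (((a.val : ℤ)) : ZMod 2) = a := fun a => by
    rw [Int.cast_natCast, ZMod.natCast_zmod_val]
  have h2 := (ZMod.intCast_eq_intCast_iff_dvd_sub ((cubicForm l x).val : ℤ)
    ((l 0).val * (x 0).val + (l 1).val * (x 1).val + (l 2).val * (x 2).val +
      (l 3).val * (x 3).val + (l 4).val * (x 0 * x 1).val + (l 5).val * (x 0 * x 2).val +
      (l 6).val * (x 0 * x 3).val + (l 7).val * (x 1 * x 2).val + (l 8).val * (x 1 * x 3).val +
      (l 9).val * (x 2 * x 3).val + (x 0 * x 1 * x 2).val) 2).1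
    (by simp only [Int.cast_add, Int.cast_mul, h, cubicForm])
  obtain ⟨q, hq⟩ := h2
  exact ⟨q, by push_cast at hq; linarith⟩

theorem HasWeights.wt_linear_combination {v : Fin 4 → Fin m → ZMod 2} {l : Fin 10 → ZMod 2}
    (h : HasWeights v l) (x : Fin 4 → ZMod 2) :
    wt (∑ k, x k • v k) % 8 = 4 * (cubicForm l x).val := by
  obtain ⟨q, hq⟩ := val_cubicForm l x
  have h0 := CodeLoops.wt_linear_combination v (x 0) (x 1) (x 2) (x 3)
  rw [Fin.sum_univ_four]
  have key : ∀ (n d e : ℕ), n % d = e → ∃ k : ℕ, (n : ℤ) = e + d * k := fun n d e hn =>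
    ⟨n / d, by rw [← hn]; exact_mod_cast (Nat.mod_add_div n d).symm⟩
  obtain ⟨k0, e0⟩ := key _ _ _ h.wt_0
  obtain ⟨k1, e1⟩ := key _ _ _ h.wt_1
  obtain ⟨k2, e2⟩ := key _ _ _ h.wt_2
  obtain ⟨k3, e3⟩ := key _ _ _ h.wt_3
  obtain ⟨k01, e01⟩ := key _ _ _ h.wt_01
  obtain ⟨k02, e02⟩ := key _ _ _ h.wt_02
  obtain ⟨k03, e03⟩ := key _ _ _ h.wt_03
  obtain ⟨k12, e12⟩ := key _ _ _ h.wt_12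
  obtain ⟨k13, e13⟩ := key _ _ _ h.wt_13
  obtain ⟨k23, e23⟩ := key _ _ _ h.wt_23
  obtain ⟨k012, e012⟩ := key _ _ _ h.wt_012
  obtain ⟨k013, e013⟩ := key _ _ _ h.wt_013
  obtain ⟨k023, e023⟩ := key _ _ _ h.wt_023
  obtain ⟨k123, e123⟩ := key _ _ _ h.wt_123
  rw [e0, e1, e2, e3, e01, e02, e03, e12, e13, e23, e012, e013, e023, e123] at h0
  have hlt : (cubicForm l x).val < 2 := ZMod.val_lt _
  suffices hs : ∃ p : ℤ, (wt (x 0 • v 0 + x 1 • v 1 + x 2 • v 2 + x 3 • v 3) : ℤ) =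
      4 * (cubicForm l x).val + 8 * p by
    obtain ⟨p, hp⟩ := hs
    omega
  rw [h0]
  push_cast
  -- The multiples of 8 collected from $4\lambda+8k$, $-2(2\lambda+4k)$ and $4(1+2k)$. Rewriting
  -- $-4\lambda$ as $4\lambda-8\lambda$ produces the terms in `l 4` to `l 9`, and `q` is the carry
  -- of the cubic form.
  refine ⟨q + (x 0).val * k0 + (x 1).val * k1 + (x 2).val * k2 + (x 3).val * k3
    - (x 0 * x 1).val * k01 - (x 0 * x 2).val * k02 - (x 0 * x 3).val * k03
    - (x 1 * x 2).val * k12 - (x 1 * x 3).val * k13 - (x 2 * x 3).val * k23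
    - (l 4).val * (x 0 * x 1).val - (l 5).val * (x 0 * x 2).val - (l 6).val * (x 0 * x 3).val
    - (l 7).val * (x 1 * x 2).val - (l 8).val * (x 1 * x 3).val - (l 9).val * (x 2 * x 3).val
    + (x 0 * x 1 * x 2).val * k012 + (x 0 * x 1 * x 3).val * k013 + (x 0 * x 2 * x 3).val * k023
    + (x 1 * x 2 * x 3).val * k123
    - (x 0 * x 1 * x 2 * x 3).val * wt (v 0 * v 1 * v 2 * v 3), ?_⟩
  linear_combination (-4) * hq

theorem HasWeights.isDoublyEven {v : Fin 4 → Fin m → ZMod 2} {l : Fin 10 → ZMod 2}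
    (h : HasWeights v l) : IsDoublyEven (Submodule.span (ZMod 2) (Set.range v)) := by
  intro w hw
  obtain ⟨x, rfl⟩ := (Submodule.mem_span_range_iff_exists_fun _).1 hw
  have := h.wt_linear_combination x
  omega

/-- `|u ∩ v| / 2` in terms of quarter weights. -/
theorem wt_mul_div_two {V : Submodule (ZMod 2) (Fin m → ZMod 2)} (hV : IsDoublyEven V) (v w : V) :
    wt v.1 / 4 + wt w.1 / 4 = wt (v + w).1 / 4 + wt (v.1 * w.1) / 2 ∧ 2 ∣ wt (v.1 * w.1) := by
  have h1 := hV _ v.2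
  have h2 := hV _ w.2
  have h3 := hV _ (v + w).2
  have h4 := wt_add v.1 w.1
  rw [← Submodule.coe_add] at h4
  omega

/-- `|u ∩ v ∩ w|` in terms of quarter weights. -/
theorem wt_mul_mul {V : Submodule (ZMod 2) (Fin m → ZMod 2)} (hV : IsDoublyEven V) (v w u : V) :
    wt (v.1 * w.1 * u.1) + wt (v + w).1 / 4 + wt (w + u).1 / 4 + wt (v + u).1 / 4 =
      wt (v + w + u).1 / 4 + wt v.1 / 4 + wt w.1 / 4 + wt u.1 / 4 := by
  have h1 := wt_mul_div_two hV v u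
  have h2 := wt_mul_div_two hV w u
  have h3 := wt_mul_div_two hV (v + w) u
  have h4 := wt_add (v.1 * u.1) (w.1 * u.1)
  have e1 : v.1 * u.1 + w.1 * u.1 = (v + w).1 * u.1 := by rw [Submodule.coe_add, add_mul]
  have e2 : v.1 * u.1 * (w.1 * u.1) = v.1 * w.1 * u.1 := by
    rw [mul_mul_mul_comm, self_mul]
  rw [e1, e2] at h4
  omega

end Weights

/-! ### Isomorphisms of Moufang loops -/

section Equivalences

variable {L M : Type*} [MoufangLoop L] [MoufangLoop M]

/-- Inverses are determined by the product: apply `e` to $x^{-1}x=1$ and cancel $e(x)$ on the right.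
-/
theorem map_inv_of_mulEquiv (e : L ≃* M) (x : L) : e x⁻¹ = (e x)⁻¹ := by
  have h1 := MoufangLoop.inv_mul_cancel_left x 1
  rw [mul_one] at h1
  have h2 := MoufangLoop.mul_inv_cancel_right (e x⁻¹) (e x)
  rwa [← map_mul, h1, map_one, one_mul, eq_comm] at h2

theorem map_commutator (e : L ≃* M) (x y : L) :
    e (commutator x y) = commutator (e x) (e y) := by
  simp only [commutator, map_mul, map_inv_of_mulEquiv]

theorem map_associator (e : L ≃* M) (x y z : L) :
    e (associator x y z) = associator (e x) (e y) (e z) := by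
  simp only [associator, map_mul, map_inv_of_mulEquiv]

end Equivalences

theorem neg_one_pow_eq_iff (a b : ℕ) : (-1 : ℤˣ) ^ a = (-1) ^ b ↔ a % 2 = b % 2 := by
  rw [Int.units_pow_eq_pow_mod_two _ a, Int.units_pow_eq_pow_mod_two _ b]
  rcases Nat.mod_two_eq_zero_or_one a with h | h <;>
    rcases Nat.mod_two_eq_zero_or_one b with h' | h' <;> rw [h, h'] <;> decide

theorem neg_one_pow_val_add (a b : ZMod 2) :
    (-1 : ℤˣ) ^ (a + b).val = (-1) ^ a.val * (-1) ^ b.val := by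
  revert a b
  decide

/-! ### Squares, commutators and associators in a code loop -/

namespace CodeLoop

variable {m : ℕ} {V : Submodule (ZMod 2) (Fin m → ZMod 2)} {hV : IsDoublyEven V}
  {φ : V → V → ℤˣ} {hφ : IsFactorSet V φ}

theorem mul_self_eq (a : CodeLoop hV hφ) : a * a = ⟨(-1) ^ (wt a.vec.1 / 4), 0⟩ := by
  ext1
  · rw [mul_sign, Int.units_mul_self, one_mul, hφ.diag]
  · exact add_self_code _

/-- All signs cancel except the three diagonal values of `φ`, whose quarter weights combine to
$|a\cap b|/2$ modulo 2. -/
theorem commutator_eq (a b : CodeLoop hV hφ) :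
    commutator a b = ⟨(-1) ^ (wt (a.vec.1 * b.vec.1) / 2), 0⟩ := by
  ext1
  · have h : φ a.vec a.vec * φ b.vec b.vec * φ (a.vec + b.vec) (a.vec + b.vec) =
        (-1) ^ (wt (a.vec.1 * b.vec.1) / 2) := by
      rw [hφ.diag, hφ.diag, hφ.diag, ← pow_add, ← pow_add, neg_one_pow_eq_iff]
      have := wt_mul_div_two hV a.vec b.vec
      omega
    simp only [commutator, mul_sign, inv_sign, mul_vec, inv_vec]
    rw [← h]
    rcases Int.units_eq_one_or a.sign with h1 | h1 <;>
      rcases Int.units_eq_one_or b.sign with h2 | h2 <;>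
      rcases Int.units_eq_one_or (φ a.vec b.vec) with h3 | h3 <;> simp [h1, h2, h3]
  · exact add_self_code (a.vec + b.vec)

theorem associator_eq (a b c : CodeLoop hV hφ) :
    associator a b c = ⟨(-1) ^ wt (a.vec.1 * b.vec.1 * c.vec.1), 0⟩ := by
  have e : a.vec + b.vec + c.vec = a.vec + (b.vec + c.vec) := add_assoc _ _ _
  ext1
  · have h := hφ.cocycle a.vec b.vec c.vec
    simp only [associator, mul_sign, inv_sign, mul_vec, inv_vec]
    rw [h, e]
    generalize φ (a.vec + (b.vec + c.vec)) (a.vec + (b.vec + c.vec)) = p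
    generalize φ a.vec (b.vec + c.vec) = q
    rcases Int.units_eq_one_or a.sign with h1 | h1 <;>
      rcases Int.units_eq_one_or b.sign with h2 | h2 <;>
      rcases Int.units_eq_one_or c.sign with h3 | h3 <;>
      rcases Int.units_eq_one_or (φ a.vec b.vec) with h4 | h4 <;>
      rcases Int.units_eq_one_or (φ b.vec c.vec) with h5 | h5 <;>
      rcases Int.units_eq_one_or p with h6 | h6 <;>
      rcases Int.units_eq_one_or q with h7 | h7 <;> simp [h1, h2, h3, h4, h5, h6, h7]
  · show a.vec + b.vec + c.vec + (a.vec + (b.vec + c.vec)) = 0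
    rw [e, add_self_code]

/-- The element `-1` of a code loop. -/
def negOne (hV : IsDoublyEven V) (hφ : IsFactorSet V φ) : CodeLoop hV hφ := ⟨-1, 0⟩

theorem mk_neg_one_pow (n : ℕ) :
    (⟨(-1) ^ n, 0⟩ : CodeLoop hV hφ) = 1 ∨ (⟨(-1) ^ n, 0⟩ : CodeLoop hV hφ) = negOne hV hφ := by
  rcases Int.units_eq_one_or ((-1) ^ n) with h | h <;> rw [h]
  exacts [Or.inl rfl, Or.inr rfl]

theorem negOnePow_negOne (c : ZMod 2) :
    negOnePow (negOne hV hφ) c = ⟨(-1) ^ c.val, 0⟩ := by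
  have hc : c = 0 ∨ c = 1 := by revert c; decide
  rcases hc with rfl | rfl <;> rfl

theorem isNegOne_negOne : IsNegOne (negOne hV hφ) where
  ne_one h := absurd (show (-1 : ℤˣ) = 1 from congrArg sign h) (by decide)
  mem_center y z := by
    rw [commutator_eq, associator_eq]
    have h1 : ∀ w : Fin m → ZMod 2, (negOne hV hφ).vec.1 * w = 0 := fun w => zero_mul w
    have h2 : wt (0 : Fin m → ZMod 2) = 0 := hammingNorm_zero
    rw [h1, zero_mul, h2]
    exact ⟨rfl, rfl⟩
  sq u := by rw [mul_self_eq]; exact mk_neg_one_pow _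
  comm u v := by rw [commutator_eq]; exact mk_neg_one_pow _
  assoc u v w := by rw [associator_eq]; exact mk_neg_one_pow _

theorem mk_neg_one_pow_eq_iff (a b : ℕ) :
    (⟨(-1) ^ a, 0⟩ : CodeLoop hV hφ) = ⟨(-1) ^ b, 0⟩ ↔ a % 2 = b % 2 := by
  rw [CodeLoop.ext_iff, neg_one_pow_eq_iff]
  simp

theorem mk_neg_one_pow_eq_one_iff (a : ℕ) :
    (⟨(-1) ^ a, 0⟩ : CodeLoop hV hφ) = 1 ↔ a % 2 = 0 :=
  mk_neg_one_pow_eq_iff a 0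

theorem mk_neg_one_pow_eq_negOne_iff (a : ℕ) :
    (⟨(-1) ^ a, 0⟩ : CodeLoop hV hφ) = negOne hV hφ ↔ a % 2 = 1 := by
  rw [← mk_neg_one_pow_eq_iff (hV := hV) (hφ := hφ) a 1, pow_one]
  rfl

theorem natCard (hV : IsDoublyEven V) (hφ : IsFactorSet V φ) :
    Nat.card (CodeLoop hV hφ) = 2 * 2 ^ Module.finrank (ZMod 2) V := by
  have e : CodeLoop hV hφ ≃ ℤˣ × V :=
    ⟨fun a => (a.sign, a.vec), fun p => ⟨p.1, p.2⟩, fun _ => rfl, fun _ => rfl⟩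
  rw [Nat.card_congr e, Nat.card_prod, Module.natCard_eq_pow_finrank (K := ZMod 2) (V := V),
    Nat.card_zmod]
  simp

/-- The relations of a characteristic vector, for generators of a code loop and its element `-1`,
amount to congruences between weights. -/
theorem relations_iff (y : Fin 4 → CodeLoop hV hφ) (l : Fin 10 → ZMod 2) :
    ((y 0 * y 0 = negOnePow (negOne hV hφ) (l 0) ∧ y 1 * y 1 = negOnePow (negOne hV hφ) (l 1) ∧
      y 2 * y 2 = negOnePow (negOne hV hφ) (l 2) ∧ y 3 * y 3 = negOnePow (negOne hV hφ) (l 3)) ∧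
    (commutator (y 0) (y 1) = negOnePow (negOne hV hφ) (l 4) ∧
      commutator (y 0) (y 2) = negOnePow (negOne hV hφ) (l 5) ∧
      commutator (y 0) (y 3) = negOnePow (negOne hV hφ) (l 6) ∧
      commutator (y 1) (y 2) = negOnePow (negOne hV hφ) (l 7) ∧
      commutator (y 1) (y 3) = negOnePow (negOne hV hφ) (l 8) ∧
      commutator (y 2) (y 3) = negOnePow (negOne hV hφ) (l 9)) ∧
    (associator (y 0) (y 1) (y 2) = negOne hV hφ ∧ associator (y 0) (y 1) (y 3) = 1 ∧
      associator (y 0) (y 2) (y 3) = 1 ∧ associator (y 1) (y 2) (y 3) = 1)) ↔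
    HasWeights (fun k => (y k).vec.1) l := by
  have hsq : ∀ (a : CodeLoop hV hφ) (c : ZMod 2),
      a * a = negOnePow (negOne hV hφ) c ↔ wt a.vec.1 % 8 = 4 * c.val := fun a c => by
    rw [mul_self_eq, negOnePow_negOne, mk_neg_one_pow_eq_iff]
    have h1 := hV _ a.vec.2
    have h2 : c.val < 2 := ZMod.val_lt c
    omega
  have hcomm : ∀ (a b : CodeLoop hV hφ) (c : ZMod 2),
      commutator a b = negOnePow (negOne hV hφ) c ↔
        wt (a.vec.1 * b.vec.1) % 4 = 2 * c.val := fun a b c => by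
    rw [commutator_eq, negOnePow_negOne, mk_neg_one_pow_eq_iff]
    have h1 := (wt_mul_div_two hV a.vec b.vec).2
    have h2 : c.val < 2 := ZMod.val_lt c
    omega
  rw [hsq, hsq, hsq, hsq, hcomm, hcomm, hcomm, hcomm, hcomm, hcomm, associator_eq, associator_eq,
    associator_eq, associator_eq, mk_neg_one_pow_eq_negOne_iff, mk_neg_one_pow_eq_one_iff,
    mk_neg_one_pow_eq_one_iff, mk_neg_one_pow_eq_one_iff]
  constructor
  · rintro ⟨⟨a, b, c, d⟩, ⟨e, f, g, h, i, j⟩, p, q, r, s⟩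
    exact ⟨a, b, c, d, e, f, g, h, i, j, p, q, r, s⟩
  · rintro ⟨a, b, c, d, e, f, g, h, i, j, p, q, r, s⟩
    exact ⟨⟨a, b, c, d⟩, ⟨e, f, g, h, i, j⟩, p, q, r, s⟩

theorem span_eq_of_generates {y : Fin 4 → CodeLoop hV hφ} (h : Generates (Set.range y)) :
    Submodule.span (ZMod 2) (Set.range fun k => (y k).vec.1) = V := by
  refine le_antisymm (Submodule.span_le.2 ?_) fun w hw => ?_
  · rintro _ ⟨k, rfl⟩
    exact (y k).vec.2
  · have h1 := h {a | a.vec.1 ∈ Submodule.span (ZMod 2) (Set.range fun k => (y k).vec.1)}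
      (by rintro _ ⟨k, rfl⟩; exact Submodule.subset_span ⟨k, rfl⟩)
      (by rw [Set.mem_ofPred_eq, one_vec]; exact Submodule.zero_mem _) (fun a ha b hb => by
        rw [Set.mem_ofPred_eq, mul_vec, Submodule.coe_add]
        exact Submodule.add_mem _ ha hb) (fun a ha => ha)
    exact (h1.symm ▸ Set.mem_univ (⟨1, ⟨w, hw⟩⟩ : CodeLoop hV hφ) :)

/-- Spanning words give every vector part with some sign; the other sign is available because $-1$
is itself an associator of generators. -/
theorem generates_of_span_eq {y : Fin 4 → CodeLoop hV hφ}
    (h : Submodule.span (ZMod 2) (Set.range fun k => (y k).vec.1) = V)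
    (hn : associator (y 0) (y 1) (y 2) = negOne hV hφ) : Generates (Set.range y) := by
  intro S hS h1 hmul hinv
  have hy : ∀ k, y k ∈ S := fun k => hS ⟨k, rfl⟩
  have hneg : negOne hV hφ ∈ S := by
    rw [← hn]
    exact hmul _ (hmul _ (hmul _ (hy 0) _ (hy 1)) _ (hy 2)) _
      (hinv _ (hmul _ (hy 0) _ (hmul _ (hy 1) _ (hy 2))))
  have hsgn : ∀ (a b : CodeLoop hV hφ), a ∈ S → a.vec = b.vec → b ∈ S := by
    intro a b ha hab
    by_cases hs : a.sign = b.sign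
    · rwa [← CodeLoop.ext hs hab]
    · have hb : b = negOne hV hφ * a := by
        ext1
        · rw [mul_sign]
          show b.sign = -1 * a.sign * φ 0 a.vec
          rw [hφ.zero_left]
          rcases Int.units_eq_one_or a.sign with h1 | h1 <;>
            rcases Int.units_eq_one_or b.sign with h2 | h2 <;> simp_all
        · show b.vec = 0 + a.vec
          rw [zero_add, hab]
      rw [hb]
      exact hmul _ hneg _ ha
  refine Set.eq_univ_of_forall fun b => ?_
  have key : ∀ w ∈ Submodule.span (ZMod 2) (Set.range fun k => (y k).vec.1),
      ∃ a ∈ S, a.vec.1 = w := by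
    intro w hw
    induction hw using Submodule.span_induction with
    | mem x hx =>
      obtain ⟨k, rfl⟩ := hx
      exact ⟨y k, hy k, rfl⟩
    | zero => exact ⟨1, h1, rfl⟩
    | add x x' _ _ hx hx' =>
      obtain ⟨a, ha, rfl⟩ := hx
      obtain ⟨a', ha', rfl⟩ := hx'
      exact ⟨a * a', hmul _ ha _ ha', rfl⟩
    | smul c x _ hx =>
      obtain ⟨a, ha, rfl⟩ := hx
      have hc : c = 0 ∨ c = 1 := by revert c; decide
      rcases hc with rfl | rfl
      · exact ⟨1, h1, (zero_smul _ _).symm⟩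
      · exact ⟨a, ha, (one_smul _ _).symm⟩
  obtain ⟨a, ha, hab⟩ := key b.vec.1 (h.symm ▸ b.vec.2)
  exact hsgn a b ha (Subtype.ext hab)

end CodeLoop

/-! ### Representations and words with prescribed weights -/

section Representations

variable {L : Type*} [MoufangLoop L] {m n : ℕ}

theorem Generates.map {M : Type*} [MoufangLoop M] (e : L ≃* M) {x : Fin 4 → L}
    (h : Generates (Set.range x)) : Generates (Set.range fun k => e (x k)) := by
  intro S hS h1 hmul hinv
  have h2 := h (e ⁻¹' S) (by rintro _ ⟨k, rfl⟩; exact hS ⟨k, rfl⟩)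
    (by rwa [Set.mem_preimage, map_one])
    (fun u hu v hv => by rw [Set.mem_preimage, map_mul]; exact hmul _ hu _ hv)
    (fun u hu => by rw [Set.mem_preimage, map_inv_of_mulEquiv]; exact hinv _ hu)
  refine Set.eq_univ_of_forall fun b => ?_
  have h3 : e.symm b ∈ e ⁻¹' S := h2 ▸ Set.mem_univ _
  rwa [Set.mem_preimage, MulEquiv.apply_symm_apply] at h3

theorem IsRepresentation.exists_hasWeights {V : Submodule (ZMod 2) (Fin m → ZMod 2)}
    (h : IsRepresentation L V) {x : Fin 4 → L} {l : Fin 10 → ZMod 2}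
    (hx : HasCharacteristicVector x l) :
    ∃ v : Fin 4 → Fin m → ZMod 2,
      Submodule.span (ZMod 2) (Set.range v) = V ∧ HasWeights v l := by
  obtain ⟨hV, φ, hφ, ⟨e⟩⟩ := h
  obtain ⟨hgen, z, hz, hsq, hcomm, hassoc⟩ := hx
  refine ⟨fun k => (e (x k)).vec.1, CodeLoop.span_eq_of_generates (hgen.map e), ?_⟩
  -- `z` is an associator different from 1, and associators in a code loop are $\pm1$.
  have hez : e z = CodeLoop.negOne hV hφ := by
    rw [← hassoc.1, map_associator, CodeLoop.associator_eq]
    refine (CodeLoop.mk_neg_one_pow _).resolve_left fun h => hz.ne_one ?_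
    rw [← CodeLoop.associator_eq, ← map_associator, hassoc.1] at h
    exact e.injective (h.trans (map_one e).symm)
  have hpow : ∀ c, e (negOnePow z c) = negOnePow (CodeLoop.negOne hV hφ) c := fun c => by
    rw [negOnePow, negOnePow, apply_ite e, hez, map_one]
  refine (CodeLoop.relations_iff (fun k => e (x k)) l).1 ?_
  simp only [← hpow]
  simp only [← hez, ← map_mul, ← map_commutator, ← map_associator, e.injective.eq_iff,
    map_eq_one_iff e e.injective]
  exact ⟨hsq, hcomm, hassoc⟩

/-- The order $2\cdot2^{\dim V}$ of the loop determines the dimension. -/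
theorem IsRepresentation.finrank_eq {V : Submodule (ZMod 2) (Fin m → ZMod 2)}
    (h : IsRepresentation L V) {r : ℕ} (hL : IsCodeLoopOfRank L r) :
    Module.finrank (ZMod 2) V = r := by
  obtain ⟨hV, φ, hφ, ⟨e⟩⟩ := h
  obtain ⟨n, W, hW, ψ, hψ, hr, ⟨e'⟩⟩ := hL
  have h1 := Nat.card_congr (e.symm.trans e').toEquiv
  rw [CodeLoop.natCard, CodeLoop.natCard, hr] at h1
  exact Nat.pow_right_injective le_rfl (Nat.eq_of_mul_eq_mul_left two_pos h1)

/-- A representation can be transported along a linear isomorphism preserving weights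
modulo 8. -/
theorem IsRepresentation.of_linearEquiv {V : Submodule (ZMod 2) (Fin m → ZMod 2)}
    {W : Submodule (ZMod 2) (Fin n → ZMod 2)} (h : IsRepresentation L W) (hV : IsDoublyEven V)
    (f : V ≃ₗ[ZMod 2] W) (hf : ∀ v, wt (f v).1 % 8 = wt v.1 % 8) : IsRepresentation L V := by
  obtain ⟨hW, φ, hφ, ⟨e⟩⟩ := h
  have hdiv : ∀ v, (wt (f v).1 / 4) % 2 = (wt v.1 / 4) % 2 := fun v => by
    have := hf v
    omega
  -- The factor set can be pulled back because intersection signs are expressible through quarter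
  -- weights modulo 2, which `f` preserves.
  have hfac : IsFactorSet V fun v w => φ (f v) (f w) := by
    refine ⟨fun v => ?_, fun v w => ?_, fun v => ?_, fun v => ?_, fun v w u => ?_⟩
    · rw [hφ.diag, neg_one_pow_eq_iff, hdiv]
    · rw [hφ.swap]
      congr 1
      rw [neg_one_pow_eq_iff]
      have h1 := wt_mul_div_two hW (f v) (f w)
      have h2 := wt_mul_div_two hV v w
      rw [← map_add] at h1
      have h3 := hdiv v
      have h4 := hdiv w
      have h5 := hdiv (v + w)
      omega
    · rw [map_zero, hφ.zero_left]
    · rw [map_zero, hφ.zero_right]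
    · rw [map_add, hφ.cocycle, map_add]
      congr 1
      rw [neg_one_pow_eq_iff]
      have h1 := wt_mul_mul hW (f v) (f w) (f u)
      have h2 := wt_mul_mul hV v w u
      simp only [← map_add] at h1
      have h3 := hdiv v
      have h4 := hdiv w
      have h5 := hdiv u
      have h6 := hdiv (v + w)
      have h7 := hdiv (w + u)
      have h8 := hdiv (v + u)
      have h9 := hdiv (v + w + u)
      omega
  let g : CodeLoop hW hφ ≃* CodeLoop hV hfac :=
    { toFun := fun a => ⟨a.sign, f.symm a.vec⟩
      invFun := fun a => ⟨a.sign, f a.vec⟩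
      left_inv := fun a => by simp
      right_inv := fun a => by simp
      map_mul' := fun a b => by ext1 <;> simp }
  exact ⟨hV, _, hfac, ⟨e.trans g⟩⟩

theorem coe_sum_equivFun {v : Fin 4 → Fin m → ZMod 2} (hv : LinearIndependent (ZMod 2) v)
    (u : Submodule.span (ZMod 2) (Set.range v)) :
    u.1 = ∑ k, (Module.Basis.span hv).equivFun u k • v k := by
  conv_lhs => rw [← (Module.Basis.span hv).sum_equivFun u]
  rw [Submodule.coe_sum]
  exact Finset.sum_congr rfl fun k _ => by
    rw [Submodule.coe_smul, Module.Basis.span_apply]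

theorem HasWeights.wt_mod_eight {v : Fin 4 → Fin m → ZMod 2} {l : Fin 10 → ZMod 2}
    (h : HasWeights v l) (hv : LinearIndependent (ZMod 2) v)
    (u : Submodule.span (ZMod 2) (Set.range v)) :
    wt u.1 % 8 = 4 * (cubicForm l ((Module.Basis.span hv).equivFun u)).val := by
  conv_lhs => rw [coe_sum_equivFun hv u]
  exact h.wt_linear_combination _

/-- Matching the two bases preserves weights modulo 8, as both are given by the same cubic form in
the coordinates. -/
theorem HasWeights.isRepresentation {v : Fin 4 → Fin m → ZMod 2} {w : Fin 4 → Fin n → ZMod 2}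
    {l : Fin 10 → ZMod 2} (h : HasWeights v l) (hv : LinearIndependent (ZMod 2) v)
    (h' : HasWeights w l) (hw : LinearIndependent (ZMod 2) w)
    (hL : IsRepresentation L (Submodule.span (ZMod 2) (Set.range w))) :
    IsRepresentation L (Submodule.span (ZMod 2) (Set.range v)) := by
  refine hL.of_linearEquiv h.isDoublyEven
    ((Module.Basis.span hv).equivFun.trans (Module.Basis.span hw).equivFun.symm) fun u => ?_
  rw [h.wt_mod_eight hv, h'.wt_mod_eight hw, LinearEquiv.trans_apply,
    LinearEquiv.apply_symm_apply]

/-- The factor set on a code spanned by four words with prescribed weights. -/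
theorem HasWeights.isFactorSet {v : Fin 4 → Fin m → ZMod 2} {l : Fin 10 → ZMod 2}
    (h : HasWeights v l) (hv : LinearIndependent (ZMod 2) v) :
    IsFactorSet (Submodule.span (ZMod 2) (Set.range v)) fun u w =>
      (-1) ^ (polarForm l ((Module.Basis.span hv).equivFun u)
        ((Module.Basis.span hv).equivFun w)).val := by
  have hV := h.isDoublyEven
  have hdiv : ∀ u : Submodule.span (ZMod 2) (Set.range v), (-1 : ℤˣ) ^ (wt u.1 / 4) =
      (-1) ^ (cubicForm l ((Module.Basis.span hv).equivFun u)).val := fun u => by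
    rw [neg_one_pow_eq_iff]
    have := h.wt_mod_eight hv u
    omega
  refine ⟨fun u => ?_, fun u w => ?_, fun u => ?_, fun u => ?_, fun u w x => ?_⟩
  · rw [hdiv, polarForm_self]
  · rw [polarForm_swap, neg_one_pow_val_add, neg_one_pow_val_add, neg_one_pow_val_add, ← map_add,
      ← hdiv, ← hdiv, ← hdiv]
    congr 1
    rw [← pow_add, ← pow_add, neg_one_pow_eq_iff]
    have := wt_mul_div_two hV u w
    omega
  · simp [polarForm]
  · simp [polarForm]
  · rw [map_add, polarForm_cocycle]
    simp only [neg_one_pow_val_add, ← map_add, ← hdiv]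
    congr 1
    simp only [← pow_add, neg_one_pow_eq_iff]
    have := wt_mul_mul hV u w x
    omega

theorem HasWeights.exists_isCodeLoopOfRank {v : Fin 4 → Fin m → ZMod 2} {l : Fin 10 → ZMod 2}
    (h : HasWeights v l) (hv : LinearIndependent (ZMod 2) v) :
    ∃ (L : Type) (_ : MoufangLoop L), IsCodeLoopOfRank L 4 ∧
      ∃ x : Fin 4 → L, HasCharacteristicVector x l := by
  have hV := h.isDoublyEven
  have hφ := h.isFactorSet hv
  refine ⟨CodeLoop hV hφ, inferInstance, ⟨m, _, hV, _, hφ, ?_, ⟨MulEquiv.refl _⟩⟩,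
    fun k => ⟨1, ⟨v k, Submodule.subset_span ⟨k, rfl⟩⟩⟩, ?_⟩
  · rw [finrank_span_eq_card hv, Fintype.card_fin]
  · have hrel := (CodeLoop.relations_iff (hV := hV) (hφ := hφ)
      (fun k => ⟨1, ⟨v k, Submodule.subset_span ⟨k, rfl⟩⟩⟩) l).2 h
    exact ⟨CodeLoop.generates_of_span_eq rfl hrel.2.2.1, _, CodeLoop.isNegOne_negOne, hrel⟩

end Representations

/-! ### The tabulated codes and their minimality -/

section Table

/-- The columns of a code of least degree for each characteristic vector. -/
def tableColumns : Fin 16 → List ℕ :=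
  ![[8, 9, 10, 11, 12, 13, 14, 15],
    [3, 3, 5, 5, 6, 6, 8, 9, 10, 11, 12, 13, 14, 15],
    [7, 7, 7, 7, 8, 9, 10, 11, 12, 13, 14, 15],
    [3, 3, 4, 4, 4, 4, 4, 4, 7, 7, 8, 9, 10, 11, 12, 13, 14, 15],
    [1, 1, 2, 2, 3, 3, 4, 4, 4, 4, 8, 9, 10, 11, 12, 13, 14, 15],
    [1, 2, 3, 4, 5, 6, 7, 8, 8, 8, 8],
    [1, 2, 3, 3, 3, 4, 5, 5, 5, 6, 6, 6, 7, 8, 8, 8, 8],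
    [1, 1, 1, 2, 3, 4, 5, 6, 7, 8, 8, 10, 10, 12, 12, 15, 15],
    [1, 2, 2, 2, 3, 3, 3, 4, 5, 6, 7, 8, 8, 10, 10, 13, 13, 14, 14],
    [1, 1, 1, 2, 2, 2, 3, 4, 4, 4, 5, 6, 6, 6, 7, 8, 8, 9, 9],
    [1, 2, 2, 2, 3, 4, 4, 4, 5, 6, 7, 7, 7, 8, 8, 9, 9],
    [1, 1, 1, 2, 3, 4, 5, 6, 7, 8, 8, 8, 8, 14, 14, 15, 15],
    [1, 1, 1, 2, 3, 4, 5, 6, 7, 8, 8, 8, 8, 8, 8, 9, 9],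
    [1, 1, 1, 2, 3, 4, 5, 6, 7, 14, 14, 15, 15],
    [1, 1, 1, 1, 1, 1, 1, 2, 3, 4, 5, 6, 7, 14, 14, 15, 15],
    [1, 1, 1, 2, 3, 4, 5, 6, 6, 6, 6, 6, 7, 8, 8, 9, 9]]

/-- Four words spanning a code of least degree for each characteristic vector. -/
def tableWords (i : Fin 16) (k : Fin 4) (j : Fin (tableDegree i)) : ZMod 2 :=
  -- Each list has exactly `tableDegree i` entries, so the default 0 is never used.
  if ((tableColumns i).getD j.val 0).testBit k.val then 1 else 0

theorem hasWeights_tableWords (i : Fin 16) : HasWeights (tableWords i) (charVector i) := by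
  revert i
  decide +kernel

theorem linearIndependent_tableWords (i : Fin 16) :
    LinearIndependent (ZMod 2) (tableWords i) := by
  rw [Fintype.linearIndependent_iff]
  have h : ∀ (i : Fin 16) (a b c d : ZMod 2),
      (∀ j, a * tableWords i 0 j + b * tableWords i 1 j + c * tableWords i 2 j +
        d * tableWords i 3 j = 0) → a = 0 ∧ b = 0 ∧ c = 0 ∧ d = 0 := by
    decide +kernel
  intro g hg k
  rw [Fin.sum_univ_four] at hg
  obtain ⟨h0, h1, h2, h3⟩ := h i (g 0) (g 1) (g 2) (g 3) fun j => congrFun hg j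
  fin_cases k
  exacts [h0, h1, h2, h3]

theorem pairwise_tableType (i : Fin 16) : (tableType i).Pairwise (· ≤ ·) := by
  revert i
  decide

theorem lt_eight_of_mem_tableType (i : Fin 16) : ∀ n ∈ tableType i, n < 8 := by
  revert i
  decide

theorem HasWeights.tableDegree_le {m : ℕ} {v : Fin 4 → Fin m → ZMod 2} {i : Fin 16}
    (h : HasWeights v (charVector i)) (hv : LinearIndependent (ZMod 2) v) :
    tableDegree i ≤ m ∧ (m = tableDegree i →
      codeType (Submodule.span (ZMod 2) (Set.range v)) = tableType i) := by
  have h1 := h.hasWeightSums.le_total (fun _ => ZMod.val_lt _)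
    (exists_mult_ne_zero (hv.ne_zero 3)) (admissible_charVector i)
  rw [total, ← sum_fin_sixteen, sum_mult] at h1
  exact ⟨h1.1, fun hm => codeType_eq_of_perm rfl (pairwise_tableType i) (h1.2 hm)⟩

variable {L : Type*} [MoufangLoop L]

theorem IsLoopC4.exists_hasWeights {i : Fin 16} (hL : IsLoopC4 i L) {m : ℕ}
    {V : Submodule (ZMod 2) (Fin m → ZMod 2)} (hV : IsRepresentation L V) :
    ∃ v : Fin 4 → Fin m → ZMod 2, Submodule.span (ZMod 2) (Set.range v) = V ∧
      HasWeights v (charVector i) ∧ LinearIndependent (ZMod 2) v := by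
  obtain ⟨x, hx⟩ := hL.2
  obtain ⟨v, hv, hw⟩ := hV.exists_hasWeights hx
  -- Four words spanning a space of dimension 4 are independent.
  refine ⟨v, hv, hw, linearIndependent_iff_card_eq_finrank_span.2 ?_⟩
  rw [Set.finrank, hv, hV.finrank_eq hL.1, Fintype.card_fin]

theorem IsLoopC4.tableDegree_le {i : Fin 16} (hL : IsLoopC4 i L) {m : ℕ}
    {V : Submodule (ZMod 2) (Fin m → ZMod 2)} (hV : IsRepresentation L V) :
    tableDegree i ≤ m ∧ (m = tableDegree i → codeType V = tableType i) := by
  obtain ⟨v, rfl, hw, hv⟩ := hL.exists_hasWeights hV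
  exact hw.tableDegree_le hv

/-- A code loop has some representation by definition; the tabulated words satisfy the same
congruences, so their span represents the same loop, in the least possible degree. -/
theorem IsLoopC4.isMinimalRepresentation {i : Fin 16} (hL : IsLoopC4 i L) :
    IsMinimalRepresentation L (Submodule.span (ZMod 2) (Set.range (tableWords i))) := by
  have hrep : IsRepresentation L (Submodule.span (ZMod 2) (Set.range (tableWords i))) := by
    obtain ⟨n, W, hW, φ, hφ, -, e⟩ := hL.1
    obtain ⟨w, rfl, hw, hli⟩ := hL.exists_hasWeights ⟨hW, φ, hφ, e⟩
    exact (hasWeights_tableWords i).isRepresentation (linearIndependent_tableWords i) hw hli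
      ⟨hW, φ, hφ, e⟩
  refine ⟨hrep, isReduced_of_codeType ?_, fun n W hW => (hL.tableDegree_le hW).1⟩
  rw [(hL.tableDegree_le hrep).2 rfl]
  exact lt_eight_of_mem_tableType i

end Table

end CodeLoops

theorem corollary4p4 (i : Fin 16) :
    (∃ (L : Type) (_ : CodeLoops.MoufangLoop L), CodeLoops.IsLoopC4 i L) ∧
    ∀ (L : Type*) [CodeLoops.MoufangLoop L], CodeLoops.IsLoopC4 i L →
      (∃ (m : ℕ) (V : Submodule (ZMod 2) (Fin m → ZMod 2)),
        CodeLoops.IsMinimalRepresentation L V) ∧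
      ∀ (m : ℕ) (V : Submodule (ZMod 2) (Fin m → ZMod 2)),
        CodeLoops.IsMinimalRepresentation L V →
          m = CodeLoops.tableDegree i ∧ CodeLoops.codeType V = CodeLoops.tableType i := by
  refine ⟨(CodeLoops.hasWeights_tableWords i).exists_isCodeLoopOfRank
    (CodeLoops.linearIndependent_tableWords i), fun L _ hL => ?_⟩
  have hmin := hL.isMinimalRepresentation
  refine ⟨⟨_, _, hmin⟩, fun m V hV => ?_⟩
  have h1 := hL.tableDegree_le hV.isRepresentation
  have h2 := le_antisymm (hV.le_degree _ _ hmin.isRepresentation) h1.1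
  exact ⟨h2, h1.2 h2⟩
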